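/- Let $0\le q<r\le m$ and $k\ge 0$ be integers. Let $S=[m]$; for $K\subseteq S$ let $\langle K\rangle\le\mathbb Z_2^m$ be the subgroup generated by the unit vectors $e_i$, $i\in K$. A subcube of type $K$ (and dimension $|K|$) is a coset $x+\langle K\rangle$. Qubits are indexed by the points of $\mathbb Z_2^m$. Put $Z(k)=|0\rangle\langle 0|+e^{i\pi/2^k}|1\rangle\langle 1|$. For a subcube $A$, the operator $U_A$ acts as $U$ on the qubits in $A$ and as the identity elsewhere, and the signed operator $\widetilde Z(k)_A$ acts as $Z(k)$ on the points of $A$ of even Hamming weight, as $Z(k)^\dagger$ on the points of $A$ of odd Hamming weight, and as the identity elsewhere. The code $QRM_m(q,r)$ is the common $+1$ eigenspace of the operators $X_A$ with $\dim A=m-q$ and $Z_A$ with $\dim A=r+1$. Let $\mathrm{Cl}^{(0)}$ be the Pauli group (with phases $\pm1,\pm i$) and $\mathrm{Cl}^{(j+1)}=\{U \text{ unitary}: U\,\mathrm{Cl}^{(0)}U^\dagger\subseteq \mathrm{Cl}^{(j)}\}$. Let $\mathcal S^{(k)}$ (level-$k$ Clifford stabilizers) be the set of $U\in\mathrm{Cl}^{(k)}$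 that fix every code state, and let the level-$k$ Clifford logicals be the $U\in\mathrm{Cl}^{(k)}\setminus\mathcal S^{(k)}$ with $U\mathcal S^{(0)}U^\dagger\subseteq\mathcal S^{(k-1)}$, where $\mathcal S^{(-1)}:=\mathcal S^{(0)}$. Write $U\equiv V$ if $V^{-1}U\in\mathcal S^{(k)}$; in particular $U\psi=V\psi$ for all code states $\psi$. Finally let $\mathcal Q_k=\{K\subseteq S: q+kr+1\le|K|\le(k+1)r\}$. **Theorem.** 1. The operators $\widetilde Z(k)_{\langle K\rangle}$, $K\in\mathcal Q_k$, form a basis for the space of logical $\widetilde Z(k)_A$ operators. That is, let $G$ be the (commutative) group generated by those $\widetilde Z(k)_A$, $A$ a subcube, that are level-$k$ Clifford logicals. Then $\widetilde Z(k)_{\langle K\rangle}$ is a level-$k$ Clifford logical for every $K\in\mathcal Q_k$; $U^2\in\mathcal S^{(k)}$ for every $U\in G$, so that $G$ modulo Clifford stabilizers is an $\mathbb F_2$-vector space; every $U\in G$ satisfies $U\equiv\prod_{K\in F}\widetilde Z(k)_{\langle K\rangle}$ for some $F\subseteq\mathcal Q_k$; and if, for $F,F'\subseteq\mathcal Q_k$,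 the products over $F$ and over $F'$ act in the same way on the code up to a global phase, then $F=F'$. 2. Let $A=x+\langle K\rangle$ be a subcube with $|K|\ge q+kr+1$, where $x$ has minimal Hamming weight in $A$, and let $I_A=\operatorname{supp}(x)$. Then $$\widetilde Z(k)_A\equiv\prod_{I\subseteq I_A:\ |I|+|K|\le(k+1)r}\widetilde Z(k)_{\langle I\cup K\rangle}.$$ 3. Under the same assumptions, the unsigned operators satisfy $$Z(k)_A\equiv\prod_{I\subseteq I_A:\ |I|+|K|\le(k+1)r}Z(k)_{\langle I\cup K\rangle}.$$ -/

import Mathlib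

noncomputable section

namespace QRM

/-! ### Qubits, unitaries and tensor products -/

/-- Unitary operators on the qubits indexed by `Q`; computational basis states are the
bit strings `Q → Fin 2`. -/
abbrev Op (Q : Type) [Fintype Q] [DecidableEq Q] : Type :=
  Matrix.unitaryGroup (Q → Fin 2) ℂ

/-- State vectors of the qubits indexed by `Q`. -/
abbrev State (Q : Type) : Type := (Q → Fin 2) → ℂ

/-- Single-qubit unitaries. -/
abbrev Gate : Type := Matrix.unitaryGroup (Fin 2) ℂ

section Tensor

set_option linter.unusedSectionVars false

variable {Q : Type} [Fintype Q] [DecidableEq Q]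

/-- The matrix of the tensor product `⨂ v, u v`. -/
def tensorMatrix (u : Q → Matrix (Fin 2) (Fin 2) ℂ) : Matrix (Q → Fin 2) (Q → Fin 2) ℂ :=
  Matrix.of fun s t => ∏ v, u v (s v) (t v)

theorem tensorMatrix_mul (u w : Q → Matrix (Fin 2) (Fin 2) ℂ) :
    tensorMatrix u * tensorMatrix w = tensorMatrix fun v => u v * w v := by
  ext s t
  simp only [tensorMatrix, Matrix.mul_apply, Matrix.of_apply, ← Finset.prod_mul_distrib]
  exact (Fintype.prod_sum fun v j => u v (s v) j * w v j (t v)).symm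

theorem tensorMatrix_one :
    tensorMatrix (fun _ : Q => (1 : Matrix (Fin 2) (Fin 2) ℂ)) = 1 := by
  ext s t
  by_cases h : s = t
  · subst h
    simp [tensorMatrix]
  · obtain ⟨v, hv⟩ := Function.ne_iff.mp h
    rw [Matrix.one_apply_ne h]
    exact Finset.prod_eq_zero (Finset.mem_univ v) (Matrix.one_apply_ne hv)

theorem tensorMatrix_star (u : Q → Matrix (Fin 2) (Fin 2) ℂ) :
    star (tensorMatrix u) = tensorMatrix fun v => star (u v) := by
  ext s t
  simp [tensorMatrix, Matrix.star_apply]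

/-- The transversal operator `⨂ v, u v`. -/
def tensor (u : Q → Gate) : Op Q :=
  ⟨tensorMatrix fun v => (u v : Matrix (Fin 2) (Fin 2) ℂ), by
    rw [Matrix.mem_unitaryGroup_iff, tensorMatrix_star, tensorMatrix_mul]
    simp only [Matrix.mem_unitaryGroup_iff.mp (u _).2]
    exact tensorMatrix_one⟩

theorem tensor_mul (u w : Q → Gate) : tensor u * tensor w = tensor fun v => u v * w v :=
  Subtype.ext (tensorMatrix_mul _ _)

theorem tensor_commute {u w : Q → Gate} (h : ∀ v, Commute (u v) (w v)) :
    Commute (tensor u) (tensor w) := by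
  unfold Commute SemiconjBy
  rw [tensor_mul, tensor_mul]
  exact congrArg tensor (funext fun v => (h v).eq)

open Classical in
/-- The operator `U_A`: it acts as `U` on the qubits in `A` and trivially elsewhere. -/
def onSet (U : Gate) (A : Set Q) : Op Q :=
  tensor fun v => if v ∈ A then U else 1

/-! ### The Pauli group, the Clifford hierarchy, and stabilizer codes -/

/-- The single-qubit Pauli group `{±1, ±i} · {I, X, Y, Z}`. -/
def pauliOne : Set Gate :=
  {P | ∃ c ∈ ({1, -1, Complex.I, -Complex.I} : Set ℂ),
    ∃ M ∈ ({1, !![0, 1; 1, 0], !![0, -Complex.I; Complex.I, 0], !![1, 0; 0, -1]} :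
      Set (Matrix (Fin 2) (Fin 2) ℂ)), (P : Matrix (Fin 2) (Fin 2) ℂ) = c • M}

/-- The Pauli group on the qubits indexed by `Q`. -/
def pauliGroup (Q : Type) [Fintype Q] [DecidableEq Q] : Set (Op Q) :=
  {P | ∃ u : Q → Gate, (∀ v, u v ∈ pauliOne) ∧ P = tensor u}

/-- The `k`-th level of the Clifford hierarchy; level `0` is the Pauli group. -/
def cliffordLevel (Q : Type) [Fintype Q] [DecidableEq Q] : ℕ → Set (Op Q)
  | 0 => pauliGroup Q
  | k + 1 => {U | ∀ P ∈ pauliGroup Q, U * P * U⁻¹ ∈ cliffordLevel Q k}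

/-- `U` fixes every vector of `C`. -/
def FixesCode (C : Submodule ℂ (State Q)) (U : Op Q) : Prop :=
  ∀ ψ ∈ C, (U : Matrix (Q → Fin 2) (Q → Fin 2) ℂ).mulVec ψ = ψ

/-- The code defined by a group of operators: its joint `+1` eigenspace. -/
def codeSpace (S : Subgroup (Op Q)) : Submodule ℂ (State Q) where
  carrier := {ψ | ∀ U ∈ S, (U : Matrix (Q → Fin 2) (Q → Fin 2) ℂ).mulVec ψ = ψ}
  add_mem' := by
    intro a b ha hb U hU
    rw [Matrix.mulVec_add, ha U hU, hb U hU]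
  zero_mem' := by
    intro U _
    rw [Matrix.mulVec_zero]
  smul_mem' := by
    intro c a ha U hU
    rw [Matrix.mulVec_smul, ha U hU]

/-- Level-`k` Clifford stabilizers of `C`. -/
def stabilizers (C : Submodule ℂ (State Q)) (k : ℕ) : Set (Op Q) :=
  {U | U ∈ cliffordLevel Q k ∧ FixesCode C U}

/-- Level-`k` undetectable Clifford errors of `C`: they conjugate Pauli stabilizers to
level-`(k-1)` Clifford stabilizers. For `k = 0` the truncated subtraction gives level `0`,
which is the usual convention. -/
def undetectable (C : Submodule ℂ (State Q)) (k : ℕ) : Set (Op Q) :=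
  {U | U ∈ cliffordLevel Q k ∧ ∀ S ∈ stabilizers C 0, U * S * U⁻¹ ∈ stabilizers C (k - 1)}

/-- Level-`k` (non-trivial) Clifford logicals of `C`. -/
def logicals (C : Submodule ℂ (State Q)) (k : ℕ) : Set (Op Q) :=
  undetectable C k \ stabilizers C k

/-- `U ≡ V` up to level-`k` Clifford stabilizers: `U = V W` with `W` a level-`k` Clifford
stabilizer. In particular `U ψ = V ψ` for all code states `ψ`. -/
def LogicallyEquiv (C : Submodule ℂ (State Q)) (k : ℕ) (U V : Op Q) : Prop :=
  V⁻¹ * U ∈ stabilizers C k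

/-- `U` and `V` act in the same way on the code, up to a global phase. -/
def AgreeUpToPhase (C : Submodule ℂ (State Q)) (U V : Op Q) : Prop :=
  ∃ c : ℂ, ‖c‖ = 1 ∧ ∀ ψ ∈ C,
    (U : Matrix (Q → Fin 2) (Q → Fin 2) ℂ).mulVec ψ =
      c • (V : Matrix (Q → Fin 2) (Q → Fin 2) ℂ).mulVec ψ

end Tensor

/-! ### Single-qubit gates -/

/-- The Pauli gate `X`. -/
def gateX : Gate :=
  ⟨!![0, 1; 1, 0], by
    rw [Matrix.mem_unitaryGroup_iff]
    ext i j
    fin_cases i <;> fin_cases j <;> simp [Matrix.mul_apply, Fin.sum_univ_two]⟩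

/-- The Pauli gate `Z`. -/
def gateZ : Gate :=
  ⟨!![1, 0; 0, -1], by
    rw [Matrix.mem_unitaryGroup_iff]
    ext i j
    fin_cases i <;> fin_cases j <;> simp [Matrix.mul_apply, Fin.sum_univ_two]⟩

/-- The rotation `Z(k) = |0⟩⟨0| + exp(iπ/2^k) |1⟩⟨1|`. -/
def rotZ (k : ℕ) : Gate :=
  ⟨!![1, 0; 0, Complex.exp (((Real.pi / 2 ^ k : ℝ) : ℂ) * Complex.I)], by
    have h : ‖Complex.exp (((Real.pi / 2 ^ k : ℝ) : ℂ) * Complex.I)‖ = 1 :=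
      Complex.norm_exp_ofReal_mul_I _
    rw [Matrix.mem_unitaryGroup_iff]
    generalize Complex.exp (((Real.pi / 2 ^ k : ℝ) : ℂ) * Complex.I) = c at h
    ext i j
    fin_cases i <;> fin_cases j <;>
      simp [Matrix.mul_apply, Fin.sum_univ_two, Matrix.star_apply, Complex.mul_conj,
        Complex.normSq_eq_norm_sq, h]⟩

/-! ### The hypercube and its subcubes -/

/-- The vertices of the `m`-dimensional hypercube. -/
abbrev Cube (m : ℕ) : Type := Fin m → ZMod 2

section Subcubes

variable {m : ℕ}

/-- The support of a bit string. -/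
def supp (x : Cube m) : Finset (Fin m) := Finset.univ.filter fun i => x i ≠ 0

/-- The standard subcube `⟨K⟩`: the subgroup generated by the unit vectors `e i`, `i ∈ K`. -/
def std (K : Finset (Fin m)) : AddSubgroup (Cube m) :=
  AddSubgroup.closure {y | ∃ i ∈ K, y = Pi.single i 1}

/-- The subcube `x + ⟨K⟩` of type `K`. -/
def subcube (x : Cube m) (K : Finset (Fin m)) : Set (Cube m) :=
  {y | ∃ z ∈ std K, y = x + z}

/-- The unsigned operator `Z(k)_A`. -/
def unsignedZ (k : ℕ) (A : Set (Cube m)) : Op (Cube m) := onSet (rotZ k) A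

open Classical in
/-- The signed operator: `Z(k)` on the vertices of `A` of even Hamming weight and its adjoint
on the vertices of `A` of odd Hamming weight. -/
def signedZ (k : ℕ) (A : Set (Cube m)) : Op (Cube m) :=
  tensor fun x => if x ∈ A then (if Even (hammingNorm x) then rotZ k else (rotZ k)⁻¹) else 1

theorem unsignedZ_commute (k : ℕ) (A B : Set (Cube m)) :
    Commute (unsignedZ k A) (unsignedZ k B) := by
  refine tensor_commute fun v => ?_
  split_ifs <;> simp

theorem signedZ_commute (k : ℕ) (A B : Set (Cube m)) :
    Commute (signedZ k A) (signedZ k B) := by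
  refine tensor_commute fun v => ?_
  split_ifs <;> simp

/-- The product of the commuting operators `Z(k)_(A i)`, `i ∈ T`. -/
def unsignedProd {ι : Type} (k : ℕ) (T : Finset ι) (A : ι → Set (Cube m)) : Op (Cube m) :=
  T.noncommProd (fun i => unsignedZ k (A i)) fun _ _ _ _ _ => unsignedZ_commute k _ _

/-- The product of the commuting signed operators on the sets `A i`, `i ∈ T`. -/
def signedProd {ι : Type} (k : ℕ) (T : Finset ι) (A : ι → Set (Cube m)) : Op (Cube m) :=
  T.noncommProd (fun i => signedZ k (A i)) fun _ _ _ _ _ => signedZ_commute k _ _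

end Subcubes

/-! ### Quantum Reed–Muller codes -/

/-- The code `QRM_m(q, r)`: the qubits are the vertices of the hypercube, and the stabilizers
are generated by `X` on the `(m-q)`-cubes and `Z` on the `(r+1)`-cubes. -/
def code (m q r : ℕ) : Submodule ℂ (State (Cube m)) :=
  codeSpace (Subgroup.closure
    ({U | ∃ (x : Cube m) (K : Finset (Fin m)), K.card = m - q ∧ U = onSet gateX (subcube x K)} ∪
     {U | ∃ (x : Cube m) (K : Finset (Fin m)), K.card = r + 1 ∧ U = onSet gateZ (subcube x K)}))

/-- The index set `𝒬_k` of the `k`-th level logical operators of `QRM_m(q, r)`. -/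
def indexSet (m q r k : ℕ) : Finset (Finset (Fin m)) :=
  Finset.univ.filter fun K => q + k * r + 1 ≤ K.card ∧ K.card ≤ (k + 1) * r

/-- The group generated by the signed subcube operators that are level-`k` Clifford logicals
of `QRM_m(q, r)`. -/
def signedGroup (m q r k : ℕ) : Subgroup (Op (Cube m)) :=
  Subgroup.closure
    {U | U ∈ logicals (code m q r) k ∧
      ∃ (x : Cube m) (K : Finset (Fin m)), U = signedZ k (subcube x K)}

end QRM

end

noncomputable section

namespace QRM

/-! ### Transversal gates in the Clifford hierarchy -/

section Gates

variable {Q : Type} [Fintype Q] [DecidableEq Q]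

theorem tensor_inv (u : Q → Gate) : (tensor u)⁻¹ = tensor fun v => (u v)⁻¹ := by
  refine inv_eq_of_mul_eq_one_right ?_
  rw [tensor_mul]
  simp only [mul_inv_cancel]
  exact Subtype.ext tensorMatrix_one

theorem tensor_one : tensor (fun _ : Q => (1 : Gate)) = 1 :=
  Subtype.ext tensorMatrix_one

/-- The Clifford hierarchy on a single qubit. -/
def gateLevel : ℕ → Set Gate
  | 0 => pauliOne
  | k + 1 => {U | ∀ P ∈ pauliOne, U * P * U⁻¹ ∈ gateLevel k}

theorem tensor_mem_cliffordLevel (k : ℕ) :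
    ∀ u : Q → Gate, (∀ v, u v ∈ gateLevel k) → tensor u ∈ cliffordLevel Q k := by
  induction k with
  | zero => exact fun u hu => ⟨u, hu, rfl⟩
  | succ k ih =>
    rintro u hu _ ⟨p, hp, rfl⟩
    rw [tensor_inv, tensor_mul, tensor_mul]
    exact ih _ fun v => hu v _ (hp v)

theorem pauliOne_cases {P : Gate} (hP : P ∈ pauliOne) :
    ∃ c e : ℂ, c ^ 4 = 1 ∧ e ^ 2 = 1 ∧
      ((P : Matrix (Fin 2) (Fin 2) ℂ) = !![c, 0; 0, e * c] ∨
        (P : Matrix (Fin 2) (Fin 2) ℂ) = !![0, c; e * c, 0]) := by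
  obtain ⟨c, hc, M, hM, h⟩ := hP
  have hc4 : c ^ 4 = 1 := by
    rcases hc with rfl | rfl | rfl | rfl
    · norm_num
    · norm_num
    · exact Complex.I_pow_four
    · rw [neg_pow, Complex.I_pow_four]; norm_num
  rcases hM with rfl | rfl | rfl | rfl
  · refine ⟨c, 1, hc4, by norm_num, Or.inl ?_⟩
    rw [h]; ext i j; fin_cases i <;> fin_cases j <;> simp
  · refine ⟨c, 1, hc4, by norm_num, Or.inr ?_⟩
    rw [h]; ext i j; fin_cases i <;> fin_cases j <;> simp
  · refine ⟨-(c * Complex.I), -1, ?_, by norm_num, Or.inr ?_⟩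
    · rw [neg_pow, mul_pow, hc4, Complex.I_pow_four]; norm_num
    · rw [h]; ext i j; fin_cases i <;> fin_cases j <;> simp
  · refine ⟨c, -1, hc4, by norm_num, Or.inl ?_⟩
    rw [h]; ext i j; fin_cases i <;> fin_cases j <;> simp

theorem mem_fourthRoots {c : ℂ} (hc : c ^ 4 = 1) :
    c ∈ ({1, -1, Complex.I, -Complex.I} : Set ℂ) := by
  have h : (c - 1) * ((c + 1) * ((c - Complex.I) * (c + Complex.I))) = 0 := by
    linear_combination hc + (1 - c ^ 2) * Complex.I_sq
  rcases mul_eq_zero.mp h with h | h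
  · exact Or.inl (sub_eq_zero.mp h)
  rcases mul_eq_zero.mp h with h | h
  · exact Or.inr (Or.inl (eq_neg_of_add_eq_zero_left h))
  rcases mul_eq_zero.mp h with h | h
  · exact Or.inr (Or.inr (Or.inl (sub_eq_zero.mp h)))
  · exact Or.inr (Or.inr (Or.inr (eq_neg_of_add_eq_zero_left h)))

theorem mem_pauliOne {P : Gate} {c e : ℂ} (hc : c ^ 4 = 1) (he : e ^ 2 = 1)
    (h : (P : Matrix (Fin 2) (Fin 2) ℂ) = !![c, 0; 0, e * c] ∨
        (P : Matrix (Fin 2) (Fin 2) ℂ) = !![0, c; e * c, 0]) : P ∈ pauliOne := by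
  rw [sq, mul_self_eq_one_iff] at he
  rcases he with rfl | rfl <;> rcases h with h | h
  · refine ⟨c, mem_fourthRoots hc, 1, by simp, ?_⟩
    rw [h]; ext i j; fin_cases i <;> fin_cases j <;> simp
  · refine ⟨c, mem_fourthRoots hc, !![0, 1; 1, 0], by simp, ?_⟩
    rw [h]; ext i j; fin_cases i <;> fin_cases j <;> simp
  · refine ⟨c, mem_fourthRoots hc, !![1, 0; 0, -1], by simp, ?_⟩
    rw [h]; ext i j; fin_cases i <;> fin_cases j <;> simp
  · refine ⟨c * Complex.I, mem_fourthRoots ?_, !![0, -Complex.I; Complex.I, 0], by simp, ?_⟩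
    · rw [mul_pow, hc, Complex.I_pow_four, mul_one]
    · rw [h]
      ext i j
      fin_cases i <;> fin_cases j <;> simp [mul_assoc]

/-- Monomial gates whose two nonzero entries differ by a root of unity of order dividing
`2 ^ (k + 1)`. -/
def IsMonomialGate (k : ℕ) (U : Gate) : Prop :=
  ∃ a e : ℂ, a ≠ 0 ∧ e ^ 2 ^ (k + 1) = 1 ∧
    ((U : Matrix (Fin 2) (Fin 2) ℂ) = !![a, 0; 0, e * a] ∨
      (U : Matrix (Fin 2) (Fin 2) ℂ) = !![0, a; e * a, 0])

theorem coe_conj_eq {U P : Gate} {M : Matrix (Fin 2) (Fin 2) ℂ}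
    (h : (U : Matrix (Fin 2) (Fin 2) ℂ) * P = M * U) :
    ((U * P * U⁻¹ : Gate) : Matrix (Fin 2) (Fin 2) ℂ) = M := by
  have h1 : ((U * U⁻¹ : Gate) : Matrix (Fin 2) (Fin 2) ℂ) = 1 := by
    rw [mul_inv_cancel]; rfl
  calc ((U * P * U⁻¹ : Gate) : Matrix (Fin 2) (Fin 2) ℂ)
      = (U : Matrix (Fin 2) (Fin 2) ℂ) * P * (U⁻¹ : Gate) := rfl
    _ = M * ((U * U⁻¹ : Gate) : Matrix (Fin 2) (Fin 2) ℂ) := by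
        rw [h, Matrix.mul_assoc]; rfl
    _ = M := by rw [h1, Matrix.mul_one]

theorem IsMonomialGate.conj {k : ℕ} {U P : Gate} (hU : IsMonomialGate (k + 1) U)
    (hP : P ∈ pauliOne) :
    ∃ c e : ℂ, c ≠ 0 ∧ e ^ 2 ^ (k + 1) = 1 ∧ (k = 0 → c ^ 4 = 1) ∧
      (((U * P * U⁻¹ : Gate) : Matrix (Fin 2) (Fin 2) ℂ) = !![c, 0; 0, e * c] ∨
        ((U * P * U⁻¹ : Gate) : Matrix (Fin 2) (Fin 2) ℂ) = !![0, c; e * c, 0]) := by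
  obtain ⟨a, e, ha, he, hU⟩ := hU
  obtain ⟨c, d, hc, hd, hP⟩ := pauliOne_cases hP
  have he0 : e ≠ 0 := by
    rintro rfl
    rw [zero_pow (by positivity)] at he
    exact zero_ne_one he
  have hc0 : c ≠ 0 := by
    rintro rfl
    norm_num at hc
  have hd0 : d ≠ 0 := by
    rintro rfl
    norm_num at hd
  have hd2 : d ^ 2 ^ (k + 1) = 1 := by rw [pow_succ', pow_mul, hd, one_pow]
  have hd4 : d ^ 4 = 1 := by rw [show 4 = 2 * 2 from rfl, pow_mul, hd, one_pow]
  have hde : (d * e ^ 2) ^ 2 ^ (k + 1) = 1 := by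
    rw [mul_pow, hd2, ← pow_mul, ← pow_succ', he, one_mul]
  have hke : k = 0 → e ^ 4 = 1 := by rintro rfl; simpa using he
  rcases hU with hU | hU <;> rcases hP with hP | hP
  · refine ⟨c, d, hc0, hd2, fun _ => hc, Or.inl (coe_conj_eq ?_)⟩
    rw [hU, hP]
    ext i j
    fin_cases i <;> fin_cases j <;> simp [Matrix.mul_apply, Fin.sum_univ_two] <;> ring
  · refine ⟨c / e, d * e ^ 2, div_ne_zero hc0 he0, hde,
      fun hk => by rw [div_pow, hc, hke hk, div_one], Or.inr (coe_conj_eq ?_)⟩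
    rw [hU, hP]
    ext i j
    fin_cases i <;> fin_cases j <;> simp [Matrix.mul_apply, Fin.sum_univ_two] <;> field_simp
  · refine ⟨d * c, d, mul_ne_zero hd0 hc0, hd2, fun _ => by rw [mul_pow, hc, hd4, one_mul],
      Or.inl (coe_conj_eq ?_)⟩
    rw [hU, hP]
    ext i j
    fin_cases i <;> fin_cases j <;> simp [Matrix.mul_apply, Fin.sum_univ_two]
    · ring
    · linear_combination -(c * e * a) * hd
  · refine ⟨d * c / e, d * e ^ 2, div_ne_zero (mul_ne_zero hd0 hc0) he0, hde,
      fun hk => by rw [div_pow, mul_pow, hc, hke hk, hd4, div_one, one_mul],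
      Or.inr (coe_conj_eq ?_)⟩
    rw [hU, hP]
    ext i j
    fin_cases i <;> fin_cases j <;> simp [Matrix.mul_apply, Fin.sum_univ_two] <;> field_simp
    linear_combination -hd

theorem IsMonomialGate.mem_gateLevel (k : ℕ) :
    ∀ U : Gate, IsMonomialGate (k + 1) U → U ∈ gateLevel (k + 1) := by
  induction k with
  | zero =>
    intro U hU P hP
    obtain ⟨c, e, -, he, hc, h⟩ := hU.conj hP
    exact mem_pauliOne (hc rfl) (by simpa using he) h
  | succ k ih =>
    intro U hU P hP
    obtain ⟨c, e, hc, he, -, h⟩ := hU.conj hP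
    exact ih _ ⟨c, e, hc, he, h⟩

/-- The diagonal gate `|0⟩⟨0| + z |1⟩⟨1|`. -/
def phaseGate (z : Circle) : Gate :=
  ⟨!![1, 0; 0, (z : ℂ)], by
    rw [Matrix.mem_unitaryGroup_iff]
    ext i j
    fin_cases i <;> fin_cases j <;>
      simp [Matrix.mul_apply, Fin.sum_univ_two, Matrix.star_apply, Complex.mul_conj]⟩

theorem phaseGate_mul (z w : Circle) : phaseGate (z * w) = phaseGate z * phaseGate w := by
  refine Subtype.ext ?_
  ext i j
  fin_cases i <;> fin_cases j <;>
    simp [phaseGate]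

theorem phaseGate_one : phaseGate 1 = 1 := by
  refine Subtype.ext ?_
  ext i j
  fin_cases i <;> fin_cases j <;> simp [phaseGate]

theorem phaseGate_inv (z : Circle) : phaseGate z⁻¹ = (phaseGate z)⁻¹ := by
  refine eq_inv_of_mul_eq_one_left ?_
  rw [← phaseGate_mul, inv_mul_cancel, phaseGate_one]

/-- The rotation angle of `Z(k)` as a point of the unit circle. -/
def rotPhase (k : ℕ) : Circle := Circle.exp (Real.pi / 2 ^ k)

theorem rotZ_eq (k : ℕ) : rotZ k = phaseGate (rotPhase k) := by
  refine Subtype.ext ?_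
  simp [rotZ, phaseGate, rotPhase, Circle.coe_exp]

theorem rotPhase_isPrimitiveRoot (k : ℕ) :
    IsPrimitiveRoot (rotPhase k : ℂ) (2 ^ (k + 1)) := by
  have h := Complex.isPrimitiveRoot_exp (2 ^ (k + 1)) (by positivity)
  convert h using 1
  rw [rotPhase, Circle.coe_exp]
  congr 1
  push_cast
  field_simp
  ring

theorem rotPhase_zpow_eq_one_iff (k : ℕ) (n : ℤ) :
    ((rotPhase k ^ n : Circle) : ℂ) = 1 ↔ (2 : ℤ) ^ (k + 1) ∣ n := by
  rw [Circle.coe_zpow, (rotPhase_isPrimitiveRoot k).zpow_eq_one_iff_dvd]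
  push_cast
  rfl

theorem phaseGate_mem_gateLevel (k : ℕ) (n : ℤ) : phaseGate (rotPhase k ^ n) ∈ gateLevel k := by
  have h : ((rotPhase k ^ n : Circle) : ℂ) ^ 2 ^ (k + 1) = 1 := by
    rw [Circle.coe_zpow, ← zpow_natCast, ← zpow_mul, mul_comm, zpow_mul, zpow_natCast,
      (rotPhase_isPrimitiveRoot k).pow_eq_one, one_zpow]
  rcases k with _ | k
  · exact mem_pauliOne (one_pow 4) (by simpa using h) (Or.inl (by simp [phaseGate]))
  · exact IsMonomialGate.mem_gateLevel k _ ⟨1, _, one_ne_zero, h, Or.inl (by simp [phaseGate])⟩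

end Gates

/-! ### Sums over powersets -/

section Powerset

variable {α : Type} [DecidableEq α]

@[to_additive]
theorem prod_powerset_powerset {M : Type} [CommMonoid M] (f : Finset α → M) (X : Finset α) :
    ∏ I ∈ X.powerset, ∏ J ∈ I.powerset, f J =
      ∏ J ∈ X.powerset, f J ^ 2 ^ (X.card - J.card) := by
  rw [Finset.prod_comm' (t' := X.powerset) (s' := fun J => Finset.Icc J X)]
  · refine Finset.prod_congr rfl fun J hJ => ?_
    rw [Finset.prod_const, Finset.card_Icc_finset (Finset.mem_powerset.mp hJ)]
  · intro I J
    simp only [Finset.mem_powerset, Finset.mem_Icc]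
    exact ⟨fun h => ⟨⟨h.2, h.1⟩, h.2.trans h.1⟩, fun h => ⟨h.1.2, h.1.1⟩⟩

theorem prod_powerset_powerset_units (g : Finset α → ℤˣ) (X : Finset α) :
    ∏ I ∈ X.powerset, ∏ J ∈ I.powerset, g J = g X := by
  rw [prod_powerset_powerset, Finset.prod_eq_single_of_mem X (Finset.mem_powerset_self X)]
  · simp
  · intro J hJ hne
    have hlt := Finset.card_lt_card (lt_of_le_of_ne (Finset.mem_powerset.mp hJ) hne)
    obtain ⟨n, hn⟩ := Nat.exists_eq_add_of_lt hlt
    rw [show X.card - J.card = n + 1 by omega, pow_succ', pow_mul, Int.units_sq, one_pow]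

/-- **McEliece's divisibility theorem**: a function of degree at most `r` in more than `k * r`
binary variables has its signed count of values divisible by `2 ^ (k + 1)`. -/
theorem two_pow_dvd_sum_powerset {r k : ℕ} (hr : 0 < r) (K : Finset α) (hK : k * r < K.card)
    (g : Finset α → ℤˣ)
    (hg : ∀ I ⊆ K, r < I.card → ∏ T ∈ I.powerset, g T = 1) :
    (2 : ℤ) ^ (k + 1) ∣ ∑ T ∈ K.powerset, (g T : ℤ) := by
  set c : Finset α → ℤˣ := fun I => ∏ T ∈ I.powerset, g T with hc
  set D := K.powerset.filter fun I => I.card ≤ r with hD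
  have hexp : ∀ T ∈ K.powerset, (g T : ℤ) =
      ∑ J ∈ D.powerset, if ∀ I ∈ J, I ⊆ T then ∏ I ∈ J, ((c I : ℤ) - 1) else 0 := by
    intro T hT
    have hTK := Finset.mem_powerset.mp hT
    have h1 : g T = ∏ I ∈ D, if I ⊆ T then c I else 1 := by
      rw [← prod_powerset_powerset_units g T, ← Finset.prod_filter]
      symm
      apply Finset.prod_subset
      · intro I hI
        simp only [Finset.mem_filter, Finset.mem_powerset] at hI ⊢
        exact hI.2
      · intro I hI hI'
        simp only [hD, Finset.mem_filter, Finset.mem_powerset, not_and] at hI hI'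
        refine hg I (hI.trans hTK) ?_
        by_contra hlt
        exact hI' ⟨hI.trans hTK, not_lt.mp hlt⟩ hI
    have h2 : (g T : ℤ) = ∏ I ∈ D, (1 + if I ⊆ T then (c I : ℤ) - 1 else 0) := by
      rw [h1, Units.coe_prod]
      refine Finset.prod_congr rfl fun I _ => ?_
      split_ifs <;> simp
    rw [h2, Finset.prod_one_add]
    refine Finset.sum_congr rfl fun J _ => ?_
    rw [Finset.prod_ite_zero]
  rw [Finset.sum_congr rfl hexp, Finset.sum_comm]
  refine Finset.dvd_sum fun J hJ => ?_
  have hJK : J.biUnion id ⊆ K := by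
    refine Finset.biUnion_subset.mpr fun I hI => ?_
    exact Finset.mem_powerset.mp (Finset.mem_filter.mp (Finset.mem_powerset.mp hJ hI)).1
  have hfilter : (K.powerset.filter fun T => ∀ I ∈ J, I ⊆ T) = Finset.Icc (J.biUnion id) K := by
    ext T
    simp only [Finset.mem_filter, Finset.mem_powerset, Finset.mem_Icc,
      Finset.biUnion_subset, id]
    exact and_comm
  rw [← Finset.sum_filter, hfilter, Finset.sum_const, Finset.card_Icc_finset hJK, nsmul_eq_mul]
  have hcard : (J.biUnion id).card ≤ J.card * r :=
    Finset.card_biUnion_le_card_mul _ _ _ fun I hI =>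
      (Finset.mem_filter.mp (Finset.mem_powerset.mp hJ hI)).2
  have hprod : (2 : ℤ) ^ J.card ∣ ∏ I ∈ J, ((c I : ℤ) - 1) := by
    rw [← Finset.prod_const]
    refine Finset.prod_dvd_prod_of_dvd _ _ fun I _ => ?_
    rcases Int.units_eq_one_or (c I) with h | h <;> simp [h]
  have hle : k + 1 ≤ (K.card - (J.biUnion id).card) + J.card := by
    by_cases hj : k + 1 ≤ J.card
    · omega
    · obtain ⟨d, rfl⟩ := Nat.exists_eq_add_of_le (show J.card ≤ k by omega)
      have : d ≤ d * r := Nat.le_mul_of_pos_right d hr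
      rw [add_mul] at hK
      omega
  refine (pow_dvd_pow 2 hle).trans ?_
  rw [pow_add]
  push_cast
  exact mul_dvd_mul_left _ hprod

end Powerset

/-! ### Sign functions on the cube -/

/-- The sign `(-1) ^ a` of a bit. -/
def sgn (a : Fin 2) : ℤˣ := if a = 0 then 1 else -1

theorem sgn_add (a b : ZMod 2) : sgn (a + b : ZMod 2) = sgn a * sgn b := by
  revert a b; decide

section Cube

variable {m : ℕ}

/-- The sign `(-1) ^ |v|` given by the parity of the Hamming weight. -/
def chi (v : Cube m) : ℤˣ := ∏ i, sgn (v i)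

theorem chi_add (v w : Cube m) : chi (v + w) = chi v * chi w := by
  simp only [chi, Pi.add_apply, sgn_add, Finset.prod_mul_distrib]

theorem chi_eq (v : Cube m) : chi v = if Even (hammingNorm v) then 1 else -1 := by
  have h : chi v = (-1) ^ hammingNorm v := by
    rw [hammingNorm, ← Finset.prod_const, Finset.prod_filter]
    refine Finset.prod_congr rfl fun i _ => ?_
    unfold sgn
    generalize v i = a
    revert a; decide
  rw [h]
  split_ifs with he
  · exact he.neg_one_pow
  · exact (Nat.not_even_iff_odd.mp he).neg_one_pow

/-- The bit string with support `T`. -/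
def ind (T : Finset (Fin m)) : Cube m := fun i => if i ∈ T then 1 else 0

@[simp]
theorem ind_empty : ind (∅ : Finset (Fin m)) = 0 := by
  ext i; simp [ind]

theorem ind_insert {a : Fin m} {T : Finset (Fin m)} (ha : a ∉ T) :
    ind (insert a T) = ind {a} + ind T := by
  ext i
  by_cases h : i = a
  · subst h; simp [ind, ha]
  · simp [ind, h]

theorem chi_ind (T : Finset (Fin m)) : chi (ind T) = (-1) ^ T.card := by
  rw [chi, ← Finset.prod_const, ← Finset.prod_subset (Finset.subset_univ T)]
  · exact Finset.prod_congr rfl fun i hi => by simp [ind, hi, sgn]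
  · intro i _ hi
    simp [ind, hi, sgn]

theorem ind_supp (x : Cube m) : ind (supp x) = x := by
  ext i
  simp only [ind, supp, Finset.mem_filter, Finset.mem_univ, true_and]
  generalize x i = a
  revert a; decide

theorem mem_std {K : Finset (Fin m)} {z : Cube m} : z ∈ std K ↔ ∀ i, i ∉ K → z i = 0 := by
  constructor
  · intro hz
    induction hz using AddSubgroup.closure_induction with
    | mem y hy =>
      obtain ⟨j, hj, rfl⟩ := hy
      intro i hi
      exact Pi.single_eq_of_ne (fun h : i = j => hi (h ▸ hj)) _
    | zero => exact fun _ _ => rfl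
    | add y z _ _ hy hz => exact fun i hi => by rw [Pi.add_apply, hy i hi, hz i hi, add_zero]
    | neg y _ hy => exact fun i hi => by rw [Pi.neg_apply, hy i hi, neg_zero]
  · intro h
    rw [← Finset.univ_sum_single z]
    refine sum_mem fun i _ => ?_
    by_cases hz : z i = 0
    · rw [hz, Pi.single_zero]
      exact zero_mem _
    · have h1 : z i = 1 := by
        revert hz
        generalize z i = a
        revert a; decide
      rw [h1]
      exact AddSubgroup.subset_closure ⟨i, by_contra fun hi => hz (h i hi), rfl⟩

theorem mem_subcube {x y : Cube m} {K : Finset (Fin m)} :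
    y ∈ subcube x K ↔ ∀ i, i ∉ K → y i = x i := by
  constructor
  · rintro ⟨z, hz, rfl⟩ i hi
    rw [Pi.add_apply, mem_std.mp hz i hi, add_zero]
  · intro h
    exact ⟨y - x, mem_std.mpr fun i hi => by rw [Pi.sub_apply, h i hi, sub_self], by abel⟩

theorem std_eq_subcube (K : Finset (Fin m)) : (std K : Set (Cube m)) = subcube 0 K := by
  ext y
  rw [SetLike.mem_coe, mem_std, mem_subcube]
  rfl

theorem subcube_eq_of_mem {x z : Cube m} {K : Finset (Fin m)} (hz : z ∈ subcube x K) :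
    subcube x K = subcube z K := by
  ext y
  rw [mem_subcube] at hz
  simp only [mem_subcube]
  exact forall₂_congr fun i hi => by rw [hz i hi]

theorem subcube_inter (x : Cube m) (K L : Finset (Fin m)) :
    subcube x K ∩ subcube x L = subcube x (K ∩ L) := by
  ext y
  simp only [Set.mem_inter_iff, mem_subcube, Finset.mem_inter, not_and_or]
  exact ⟨fun h i hi => hi.elim (h.1 i) (h.2 i),
    fun h => ⟨fun i hi => h i (Or.inl hi), fun i hi => h i (Or.inr hi)⟩⟩

open Classical in
@[to_additive]
theorem prod_subcube {M : Type} [CommMonoid M] (x : Cube m) (K : Finset (Fin m))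
    (f : Cube m → M) :
    (∏ v, if v ∈ subcube x K then f v else 1) = ∏ T ∈ K.powerset, f (x + ind T) := by
  have hz : ∀ a b : ZMod 2, b + (if a ≠ b then 1 else 0) = a := by decide
  rw [← Finset.prod_filter]
  refine Finset.prod_bij' (fun v _ => Finset.univ.filter fun i => v i ≠ x i)
    (fun T _ => x + ind T) ?_ ?_ ?_ ?_ ?_
  · intro v hv
    rw [Finset.mem_powerset]
    intro i hi
    simp only [Finset.mem_filter, Finset.mem_univ, true_and, mem_subcube] at hv hi
    exact by_contra fun h => hi (hv i h)
  · intro T hT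
    simp only [Finset.mem_filter, Finset.mem_univ, true_and, mem_subcube]
    intro i hi
    have : i ∉ T := fun h => hi (Finset.mem_powerset.mp hT h)
    simp [ind, this]
  · intro v _
    ext i
    simp only [Pi.add_apply, ind, Finset.mem_filter, Finset.mem_univ, true_and]
    exact hz _ _
  · intro T _
    ext i
    by_cases hi : i ∈ T <;> simp [ind, hi]
  · intro v _
    congr 1
    ext i
    simp only [Pi.add_apply, ind, Finset.mem_filter, Finset.mem_univ, true_and]
    exact (hz _ _).symm

@[to_additive]
theorem prod_powerset_ind_insert {M : Type} [CommMonoid M] (x : Cube m) {a : Fin m}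
    {K : Finset (Fin m)} (ha : a ∉ K) (f : Cube m → M) :
    ∏ T ∈ (insert a K).powerset, f (x + ind T) =
      (∏ T ∈ K.powerset, f (x + ind T)) * ∏ T ∈ K.powerset, f (x + ind {a} + ind T) := by
  rw [Finset.prod_powerset_insert ha]
  congr 1
  refine Finset.prod_congr rfl fun T hT => ?_
  rw [ind_insert fun h => ha (Finset.mem_powerset.mp hT h), add_assoc]

@[to_additive]
theorem prod_powerset_ind_union {M : Type} [CommMonoid M] (f : Cube m → M)
    (I K : Finset (Fin m)) (h : Disjoint I K) (x : Cube m) :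
    ∏ T ∈ (I ∪ K).powerset, f (x + ind T) =
      ∏ J ∈ I.powerset, ∏ T ∈ K.powerset, f (x + ind J + ind T) := by
  induction I using Finset.induction_on generalizing x with
  | empty => simp
  | insert a I ha ih =>
    rw [Finset.disjoint_insert_left] at h
    rw [Finset.insert_union, prod_powerset_ind_insert _ (by simp [ha, h.1]), ih h.2, ih h.2,
      Finset.prod_powerset_insert ha]
    congr 1
    refine Finset.prod_congr rfl fun J hJ => ?_
    rw [ind_insert fun h => ha (Finset.mem_powerset.mp hJ h), add_assoc x]

/-- `(-1) ^ f` for a Boolean function `f` of degree at most `r`, that is, one whose sum over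
every subcube of dimension `r + 1` is even. -/
def LowDegree (r : ℕ) (g : Cube m → ℤˣ) : Prop :=
  ∀ (x : Cube m) (K : Finset (Fin m)), K.card = r + 1 →
    ∏ T ∈ K.powerset, g (x + ind T) = 1

theorem LowDegree.one (r : ℕ) : LowDegree r fun _ : Cube m => (1 : ℤˣ) :=
  fun _ _ _ => Finset.prod_const_one

theorem LowDegree.mul {r : ℕ} {g h : Cube m → ℤˣ} (hg : LowDegree r g) (hh : LowDegree r h) :
    LowDegree r fun v => g v * h v := fun x K hK => by
  rw [Finset.prod_mul_distrib, hg x K hK, hh x K hK, one_mul]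

theorem LowDegree.translate {r : ℕ} {g : Cube m → ℤˣ} (hg : LowDegree r g) (y : Cube m) :
    LowDegree r fun v => g (y + v) := fun x K hK => by
  simp only [← add_assoc]
  exact hg _ K hK

theorem LowDegree.prod_eq_one {r : ℕ} {g : Cube m → ℤˣ} (hg : LowDegree r g)
    (K : Finset (Fin m)) (hK : r < K.card) (x : Cube m) :
    ∏ T ∈ K.powerset, g (x + ind T) = 1 := by
  induction K using Finset.induction_on generalizing x with
  | empty => simp at hK
  | insert a K ha ih =>
    by_cases h : (insert a K).card = r + 1
    · exact hg x _ h
    · rw [Finset.card_insert_of_notMem ha] at h hK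
      rw [prod_powerset_ind_insert x ha, ih (by omega), ih (by omega), one_mul]

theorem LowDegree.dvd_sum {r k : ℕ} {g : Cube m → ℤˣ} (hg : LowDegree r g) (hr : 0 < r)
    (x : Cube m) {K : Finset (Fin m)} (hK : k * r < K.card) :
    (2 : ℤ) ^ (k + 1) ∣ ∑ T ∈ K.powerset, (g (x + ind T) : ℤ) :=
  two_pow_dvd_sum_powerset hr K hK (fun T => g (x + ind T))
    fun I _ hI => hg.prod_eq_one I hI x

theorem chi_lowDegree {r : ℕ} (hr : 0 < r) : LowDegree r (chi : Cube m → ℤˣ) := by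
  intro x K hK
  obtain ⟨a, ha⟩ := Finset.card_pos.mp (show 0 < K.card by omega)
  have hcard := Finset.card_erase_of_mem ha
  rw [← Finset.insert_erase ha, prod_powerset_ind_insert x (Finset.notMem_erase a K),
    ← Finset.prod_mul_distrib]
  have h : ∀ T ∈ (K.erase a).powerset,
      chi (x + ind T) * chi (x + ind {a} + ind T) = -1 := by
    intro T _
    have h1 : chi (ind ({a} : Finset (Fin m))) = -1 := by simp [chi_ind]
    rw [chi_add, chi_add, chi_add, h1]
    have hx := Int.units_mul_self (chi x)
    have hT := Int.units_mul_self (chi (ind T))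
    calc _ = -((chi x * chi x) * (chi (ind T) * chi (ind T))) := by
          simp only [mul_neg, mul_one, neg_mul]
          congr 1
          exact mul_mul_mul_comm _ _ _ _
      _ = -1 := by rw [hx, hT, one_mul]
  rw [Finset.prod_congr rfl h, Finset.prod_const, Finset.card_powerset]
  obtain ⟨d, hd⟩ := Nat.exists_eq_succ_of_ne_zero (show (K.erase a).card ≠ 0 by omega)
  rw [hd, pow_succ', pow_mul, Int.units_sq, one_pow]

theorem prod_powerset_ind_eq_one_of_invariant {g : Cube m → ℤˣ} {a : Fin m}
    (hg : ∀ v, g (v + ind {a}) = g v) {K : Finset (Fin m)} (ha : a ∈ K) (x : Cube m) :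
    ∏ T ∈ K.powerset, g (x + ind T) = 1 := by
  rw [← Finset.insert_erase ha, prod_powerset_ind_insert x (Finset.notMem_erase a K),
    ← Finset.prod_mul_distrib]
  refine Finset.prod_eq_one fun T _ => ?_
  rw [add_right_comm, hg, Int.units_mul_self]

open Classical in
theorem indicator_lowDegree {r : ℕ} (x : Cube m) {L : Finset (Fin m)} (hL : m ≤ L.card + r) :
    LowDegree r fun v => if v ∈ subcube x L then (-1 : ℤˣ) else 1 := by
  intro y K hK
  obtain ⟨a, ha⟩ : (K ∩ L).Nonempty := by
    rw [← Finset.card_pos]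
    have h1 := Finset.card_union_add_card_inter K L
    have h2 := Finset.card_le_univ (K ∪ L)
    rw [Fintype.card_fin] at h2
    omega
  rw [Finset.mem_inter] at ha
  refine prod_powerset_ind_eq_one_of_invariant
    (g := fun v => if v ∈ subcube x L then (-1 : ℤˣ) else 1) (a := a) (fun v => ?_) ha.1 y
  have : v + ind {a} ∈ subcube x L ↔ v ∈ subcube x L := by
    simp only [mem_subcube]
    refine forall₂_congr fun i hi => ?_
    have : i ≠ a := fun h => hi (h ▸ ha.2)
    simp [ind, this]
  simp only [this]

/-- `(-1) ^ f` for the monomial `f` in the variables `N`. -/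
def monomialSign (N : Finset (Fin m)) (v : Cube m) : ℤˣ := if ∀ i ∈ N, v i = 1 then -1 else 1

theorem monomialSign_add {N J : Finset (Fin m)} (h : Disjoint J N) (v : Cube m) :
    monomialSign N (v + ind J) = monomialSign N v := by
  unfold monomialSign
  have : (∀ i ∈ N, (v + ind J) i = 1) ↔ ∀ i ∈ N, v i = 1 := by
    refine forall₂_congr fun i hi => ?_
    have : i ∉ J := fun hJ => Finset.disjoint_left.mp h hJ hi
    simp [ind, this]
  simp only [this]

theorem monomialSign_lowDegree {r : ℕ} {N : Finset (Fin m)} (hN : N.card ≤ r) :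
    LowDegree r (monomialSign N) := by
  intro x K hK
  obtain ⟨a, ha, haN⟩ := Finset.exists_mem_notMem_of_card_lt_card (show N.card < K.card by omega)
  exact prod_powerset_ind_eq_one_of_invariant
    (fun v => monomialSign_add (Finset.disjoint_singleton_left.mpr haN) v) ha x

theorem sum_chi_eq_zero {g : Cube m → ℤˣ} {a : Fin m} (hg : ∀ v, g (v + ind {a}) = g v)
    {K : Finset (Fin m)} (ha : a ∈ K) (x : Cube m) :
    ∑ T ∈ K.powerset, ((chi (x + ind T) * g (x + ind T) : ℤˣ) : ℤ) = 0 := by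
  rw [← Finset.insert_erase ha, sum_powerset_ind_insert x (Finset.notMem_erase a K)
    (fun v => ((chi v * g v : ℤˣ) : ℤ)), ← Finset.sum_add_distrib]
  refine Finset.sum_eq_zero fun T _ => ?_
  rw [add_right_comm, hg, chi_add _ (ind {a}), chi_ind]
  simp

theorem sum_chi_monomialSign {N : Finset (Fin m)} (hN : N.Nonempty) :
    ∑ J ∈ N.powerset, ((chi (ind J) * monomialSign N (ind J) : ℤˣ) : ℤ) =
      -2 * (-1) ^ N.card := by
  obtain ⟨a, ha⟩ := hN
  have h0 := sum_chi_eq_zero (g := fun _ : Cube m => 1) (fun _ => rfl) ha 0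
  simp only [zero_add, mul_one] at h0
  rw [← sub_zero (∑ J ∈ N.powerset, _), ← h0, ← Finset.sum_sub_distrib,
    Finset.sum_eq_single_of_mem N (Finset.mem_powerset_self N)]
  · have : monomialSign N (ind N) = -1 := if_pos fun i hi => by simp [ind, hi]
    rw [this, chi_ind]
    push_cast
    ring
  · intro J hJ hne
    have : monomialSign N (ind J) = 1 := by
      refine if_neg fun h => hne ?_
      refine (Finset.mem_powerset.mp hJ).antisymm fun i hi => by_contra fun hiJ => ?_
      have := h i hi
      simp [ind, hiJ] at this
    rw [this, mul_one, sub_self]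

/-- Tightness of the divisibility theorem: a product of `n` monomials of degree at most `r` in
disjoint sets of variables. -/
theorem exists_lowDegree_sum_chi {r : ℕ} (n : ℕ) :
    ∀ M : Finset (Fin m), M.card ≤ n * r → ∃ g : Cube m → ℤˣ, LowDegree r g ∧
      (∀ v J, Disjoint J M → g (v + ind J) = g v) ∧
      ∃ j ≤ n, (∑ T ∈ M.powerset, ((chi (ind T) * g (ind T) : ℤˣ) : ℤ)).natAbs = 2 ^ j := by
  induction n with
  | zero =>
    intro M hM
    obtain rfl : M = ∅ := Finset.card_eq_zero.mp (by omega)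
    refine ⟨fun _ => 1, LowDegree.one r, fun _ _ _ => rfl, 0, le_rfl, ?_⟩
    simp [chi, sgn]
  | succ n ih =>
    intro M hM
    by_cases hMn : M.card ≤ n * r
    · obtain ⟨g, h1, h2, j, hj, h3⟩ := ih M hMn
      exact ⟨g, h1, h2, j, by omega, h3⟩
    rw [add_mul, one_mul] at hM
    obtain ⟨M₁, hM₁, hcard⟩ := Finset.exists_subset_card_eq (show n * r ≤ M.card by omega)
    obtain ⟨g, h1, h2, j, hj, h3⟩ := ih M₁ hcard.le
    have hNcard := Finset.card_sdiff_of_subset hM₁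
    set N := M \ M₁ with hN
    have hdisj : Disjoint N M₁ := Finset.sdiff_disjoint
    have hunion : N ∪ M₁ = M := Finset.sdiff_union_of_subset hM₁
    have hne : N.Nonempty := Finset.card_pos.mp (by omega)
    refine ⟨fun v => g v * monomialSign N v, h1.mul (monomialSign_lowDegree (by omega)),
      fun v J hJ => ?_, j + 1, by omega, ?_⟩
    · rw [← hunion, Finset.disjoint_union_right] at hJ
      show g _ * monomialSign N _ = _
      rw [h2 v J hJ.2, monomialSign_add hJ.1]
    · have hsum : ∑ T ∈ M.powerset, ((chi (ind T) * (g (ind T) * monomialSign N (ind T)) : ℤˣ) : ℤ)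
          = (∑ J ∈ N.powerset, ((chi (ind J) * monomialSign N (ind J) : ℤˣ) : ℤ)) *
            ∑ T ∈ M₁.powerset, ((chi (ind T) * g (ind T) : ℤˣ) : ℤ) := by
        have h := sum_powerset_ind_union
          (fun v : Cube m => ((chi v * (g v * monomialSign N v) : ℤˣ) : ℤ)) N M₁ hdisj 0
        simp only [zero_add, hunion] at h
        rw [h, Finset.sum_mul_sum]
        refine Finset.sum_congr rfl fun J hJ => Finset.sum_congr rfl fun T hT => ?_
        have hT' : Disjoint T N :=
          (hdisj.mono_right (Finset.mem_powerset.mp hT)).symm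
        have hJ' : Disjoint J M₁ := hdisj.mono_left (Finset.mem_powerset.mp hJ)
        rw [monomialSign_add hT', add_comm (ind J), h2 _ J hJ', chi_add]
        push_cast
        ring
      rw [hsum, sum_chi_monomialSign hne, Int.natAbs_mul, h3, Int.natAbs_mul, Int.natAbs_pow]
      simp [pow_succ']

end Cube

/-! ### Diagonal operators -/

section PhaseOp

variable {Q : Type} [Fintype Q] [DecidableEq Q]

theorem tensor_mulVec (u : Q → Gate) (p : Q → Fin 2 → Fin 2) (c : Q → Fin 2 → ℂ)
    (hu : ∀ v i j, (u v : Matrix (Fin 2) (Fin 2) ℂ) i j = if j = p v i then c v i else 0)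
    (ψ : State Q) (s : Q → Fin 2) :
    (tensor u : Matrix (Q → Fin 2) (Q → Fin 2) ℂ).mulVec ψ s =
      (∏ v, c v (s v)) * ψ fun v => p v (s v) := by
  have h : ∀ t, (tensor u : Matrix (Q → Fin 2) (Q → Fin 2) ℂ) s t =
      ∏ v, if t v = p v (s v) then c v (s v) else 0 := fun t =>
    Finset.prod_congr rfl fun v _ => hu v _ _
  rw [Matrix.mulVec, dotProduct, Finset.sum_eq_single (fun v => p v (s v))]
  · rw [h]
    simp
  · intro t _ ht
    obtain ⟨v, hv⟩ := Function.ne_iff.mp ht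
    rw [h, Finset.prod_eq_zero (Finset.mem_univ v) (if_neg hv), zero_mul]
  · exact fun hn => absurd (Finset.mem_univ _) hn

theorem coe_mul_mulVec (U V : Op Q) (ψ : State Q) :
    ((U * V : Op Q) : Matrix (Q → Fin 2) (Q → Fin 2) ℂ).mulVec ψ =
      (U : Matrix (Q → Fin 2) (Q → Fin 2) ℂ).mulVec
        ((V : Matrix (Q → Fin 2) (Q → Fin 2) ℂ).mulVec ψ) :=
  (Matrix.mulVec_mulVec ψ _ _).symm

/-- The transversal operator `⨂ v, Z(k) ^ a v`. -/
def phaseOp (k : ℕ) (a : Q → ℤ) : Op Q := tensor fun v => phaseGate (rotPhase k ^ a v)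

theorem phaseOp_add (k : ℕ) (a b : Q → ℤ) : phaseOp k (a + b) = phaseOp k a * phaseOp k b := by
  simp only [phaseOp, tensor_mul, ← phaseGate_mul, Pi.add_apply, zpow_add]

theorem phaseOp_zero (k : ℕ) : phaseOp k (0 : Q → ℤ) = 1 := by
  simp only [phaseOp, Pi.zero_apply, zpow_zero, phaseGate_one, tensor_one]

theorem phaseOp_neg (k : ℕ) (a : Q → ℤ) : phaseOp k (-a) = (phaseOp k a)⁻¹ := by
  refine eq_inv_of_mul_eq_one_left ?_
  rw [← phaseOp_add, neg_add_cancel, phaseOp_zero]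

theorem phaseOp_mem_cliffordLevel (k : ℕ) (a : Q → ℤ) : phaseOp k a ∈ cliffordLevel Q k :=
  tensor_mem_cliffordLevel k _ fun v => phaseGate_mem_gateLevel k (a v)

theorem rotPhase_succ_sq (k : ℕ) : rotPhase (k + 1) ^ 2 = rotPhase k := by
  rw [sq, rotPhase, rotPhase, ← Circle.exp_add]
  congr 1
  rw [pow_succ]
  ring

theorem phaseOp_eq_succ (k : ℕ) (a : Q → ℤ) : phaseOp k a = phaseOp (k + 1) (2 * a) := by
  simp only [phaseOp, Pi.mul_apply, Pi.ofNat_apply, zpow_mul, ← rotPhase_succ_sq k]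
  rfl

theorem phaseOp_conj_mem_cliffordLevel (k : ℕ) (a : Q → ℤ) {P : Op Q} (hP : P ∈ pauliGroup Q) :
    phaseOp k a * P * (phaseOp k a)⁻¹ ∈ cliffordLevel Q (k - 1) := by
  rcases k with _ | k
  · rw [phaseOp_eq_succ]
    exact phaseOp_mem_cliffordLevel 1 (2 * a) P hP
  · exact phaseOp_mem_cliffordLevel (k + 1) a P hP

/-- The sum of `a` over the support of `s`. -/
def weight (s : Q → Fin 2) : (Q → ℤ) →+ ℤ where
  toFun a := ∑ v, if s v = 0 then 0 else a v
  map_zero' := by simp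
  map_add' a b := by
    rw [← Finset.sum_add_distrib]
    refine Finset.sum_congr rfl fun v _ => ?_
    split_ifs <;> simp

theorem phaseOp_mulVec (k : ℕ) (a : Q → ℤ) (ψ : State Q) (s : Q → Fin 2) :
    (phaseOp k a : Matrix (Q → Fin 2) (Q → Fin 2) ℂ).mulVec ψ s =
      ((rotPhase k ^ weight s a : Circle) : ℂ) * ψ s := by
  have h := tensor_mulVec (fun v => phaseGate (rotPhase k ^ a v)) (fun _ i => i)
    (fun v i => if i = 0 then 1 else ((rotPhase k ^ a v : Circle) : ℂ)) ?_ ψ s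
  · refine h.trans ?_
    congr 1
    have hw : (rotPhase k ^ weight s a : Circle) =
        ∏ v, if s v = 0 then 1 else rotPhase k ^ a v := by
      have : ∀ v, (if s v = 0 then 1 else rotPhase k ^ a v : Circle) =
          rotPhase k ^ (if s v = 0 then 0 else a v) := fun v => by split_ifs <;> simp
      simp only [this]
      exact map_sum (M := ℤ) (zpowersHom Circle (rotPhase k)).toAdditiveRight _ _
    rw [hw]
    refine Eq.trans ?_ (map_prod Circle.coeHom _ _).symm
    refine Finset.prod_congr rfl fun v _ => ?_
    split_ifs
    · exact (map_one Circle.coeHom).symm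
    · rfl
  · intro v i j
    fin_cases i <;> fin_cases j <;> simp [phaseGate]

open Classical in
/-- The bit string `s` with the bits in `A` flipped. -/
def flip (A : Set Q) (s : Q → Fin 2) : Q → Fin 2 := fun v => if v ∈ A then s v + 1 else s v

theorem onSet_gateX_mulVec (A : Set Q) (ψ : State Q) (s : Q → Fin 2) :
    (onSet gateX A : Matrix (Q → Fin 2) (Q → Fin 2) ℂ).mulVec ψ s = ψ (flip A s) := by
  classical
  have h := tensor_mulVec (fun v => if v ∈ A then gateX else 1)
    (fun v i => if v ∈ A then i + 1 else i) (fun _ _ => 1) ?_ ψ s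
  · simp only [Finset.prod_const_one, one_mul] at h
    convert h using 1
    · congr!
    · congr!
  · intro v i j
    by_cases hv : v ∈ A <;> simp only [hv, if_true, if_false]
    · fin_cases i <;> fin_cases j <;> simp [gateX]
    · fin_cases i <;> fin_cases j <;> simp

open Classical in
theorem onSet_gateZ_mulVec (A : Set Q) (ψ : State Q) (s : Q → Fin 2) :
    (onSet gateZ A : Matrix (Q → Fin 2) (Q → Fin 2) ℂ).mulVec ψ s =
      (((∏ v, if v ∈ A then sgn (s v) else 1 : ℤˣ) : ℤ) : ℂ) * ψ s := by
  have h := tensor_mulVec (fun v => if v ∈ A then gateZ else 1)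
    (fun v i => i) (fun v i => if v ∈ A then ((sgn i : ℤ) : ℂ) else 1) ?_ ψ s
  · refine h.trans ?_
    congr 1
    push_cast
    refine Finset.prod_congr rfl fun v _ => ?_
    split_ifs <;> simp
  · intro v i j
    by_cases hv : v ∈ A <;> simp only [hv, if_true, if_false]
    · fin_cases i <;> fin_cases j <;> simp [gateZ, sgn]
    · fin_cases i <;> fin_cases j <;> simp

theorem onSet_gateX_mem_pauliGroup (A : Set Q) : onSet gateX A ∈ pauliGroup Q := by
  refine ⟨_, fun v => ?_, rfl⟩
  split_ifs
  · exact ⟨1, by simp, !![0, 1; 1, 0], by simp, by simp [gateX]⟩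
  · exact ⟨1, by simp, 1, by simp, by simp⟩

theorem mem_codeSpace_closure {G : Set (Op Q)} {ψ : State Q} :
    ψ ∈ codeSpace (Subgroup.closure G) ↔
      ∀ U ∈ G, (U : Matrix (Q → Fin 2) (Q → Fin 2) ℂ).mulVec ψ = ψ := by
  refine ⟨fun h U hU => h U (Subgroup.subset_closure hU), fun h U hU => ?_⟩
  induction hU using Subgroup.closure_induction with
  | mem U hU => exact h U hU
  | one => exact Matrix.one_mulVec ψ
  | mul U V _ _ hU hV => rw [coe_mul_mulVec, hV, hU]
  | inv U _ hU =>
    nth_rewrite 1 [← hU]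
    rw [← coe_mul_mulVec, inv_mul_cancel]
    exact Matrix.one_mulVec ψ

end PhaseOp

/-! ### The code -/

section Code

variable {m q r k : ℕ}

/-- Bit strings that are evaluations of Boolean functions of degree at most `r`. -/
def IsCodeword (r : ℕ) (s : Cube m → Fin 2) : Prop := LowDegree r fun v => sgn (s v)

open Classical in
theorem sgn_flip (A : Set (Cube m)) (s : Cube m → Fin 2) (v : Cube m) :
    sgn (flip A s v) = sgn (s v) * if v ∈ A then -1 else 1 := by
  unfold flip
  split_ifs with h
  · generalize s v = a
    revert a; decide
  · rw [mul_one]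

theorem flip_flip (A : Set (Cube m)) (s : Cube m → Fin 2) : flip A (flip A s) = s := by
  ext1 v
  unfold flip
  split_ifs with h
  · generalize s v = a
    revert a; decide
  · rfl

theorem IsCodeword.flip {s : Cube m → Fin 2} (hs : IsCodeword r s) (x : Cube m)
    {L : Finset (Fin m)} (hL : m ≤ L.card + r) : IsCodeword r (flip (subcube x L) s) := by
  unfold IsCodeword
  simp only [sgn_flip]
  exact hs.mul (indicator_lowDegree x hL)

theorem isCodeword_flip_iff {s : Cube m → Fin 2} (x : Cube m) {L : Finset (Fin m)}
    (hL : m ≤ L.card + r) : IsCodeword r (flip (subcube x L) s) ↔ IsCodeword r s :=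
  ⟨fun h => flip_flip (subcube x L) s ▸ h.flip x hL, fun h => h.flip x hL⟩

theorem exists_isCodeword {g : Cube m → ℤˣ} (hg : LowDegree r g) :
    ∃ s : Cube m → Fin 2, IsCodeword r s ∧ ∀ v, sgn (s v) = g v := by
  have h : ∀ v, sgn (if g v = 1 then 0 else 1) = g v := fun v => by
    rcases Int.units_eq_one_or (g v) with h | h <;> rw [h] <;> decide
  exact ⟨fun v => if g v = 1 then 0 else 1, by simpa only [IsCodeword, h] using hg, h⟩

theorem mem_code_iff {ψ : State (Cube m)} :
    ψ ∈ code m q r ↔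
      (∀ (x : Cube m) (L : Finset (Fin m)), L.card = m - q →
        ∀ s, ψ (flip (subcube x L) s) = ψ s) ∧
      ∀ s, ¬ IsCodeword r s → ψ s = 0 := by
  classical
  rw [code, mem_codeSpace_closure]
  constructor
  · intro h
    refine ⟨fun x L hL s => ?_, fun s hs => ?_⟩
    · rw [← onSet_gateX_mulVec (subcube x L) ψ, h _ (Or.inl ⟨x, L, hL, rfl⟩)]
    · unfold IsCodeword LowDegree at hs
      push Not at hs
      obtain ⟨x, K, hK, hne⟩ := hs
      have h1 := congrFun (h _ (Or.inr ⟨x, K, hK, rfl⟩)) s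
      rw [onSet_gateZ_mulVec, prod_subcube x K fun v => sgn (s v),
        (Int.units_eq_one_or _).resolve_left hne] at h1
      push_cast at h1
      linear_combination (-1 / 2 : ℂ) * h1
  · rintro ⟨h1, h2⟩ U (⟨x, L, hL, rfl⟩ | ⟨x, K, hK, rfl⟩)
    · ext s
      rw [onSet_gateX_mulVec, h1 x L hL]
    · ext s
      rw [onSet_gateZ_mulVec, prod_subcube x K fun v => sgn (s v)]
      by_cases hs : IsCodeword r s
      · rw [hs x K hK]
        simp
      · rw [h2 s hs, mul_zero]

open Classical in
/-- The uniform superposition of all codewords. -/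
def uniformState (m r : ℕ) : State (Cube m) := fun s => if IsCodeword r s then 1 else 0

theorem uniformState_of_isCodeword {s : Cube m → Fin 2} (hs : IsCodeword r s) :
    uniformState m r s = 1 := if_pos hs

theorem uniformState_mem_code (hqr : q ≤ r) : uniformState m r ∈ code m q r := by
  classical
  rw [mem_code_iff]
  refine ⟨fun x L hL s => ?_, fun s hs => if_neg hs⟩
  exact if_congr (isCodeword_flip_iff x (by omega)) rfl rfl

theorem phaseOp_mulVec_mem_code {a : Cube m → ℤ}
    (ha : ∀ (x : Cube m) (L : Finset (Fin m)), L.card = m - q → ∀ s, IsCodeword r s →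
      (2 : ℤ) ^ (k + 1) ∣ weight (flip (subcube x L) s) a - weight s a)
    {ψ : State (Cube m)} (hψ : ψ ∈ code m q r) :
    (phaseOp k a : Matrix (Cube m → Fin 2) (Cube m → Fin 2) ℂ).mulVec ψ ∈ code m q r := by
  rw [mem_code_iff] at hψ ⊢
  refine ⟨fun x L hL s => ?_, fun s hs => ?_⟩
  · rw [phaseOp_mulVec, phaseOp_mulVec, hψ.1 x L hL]
    by_cases hs : IsCodeword r s
    · rw [← sub_add_cancel (weight (flip _ s) a) (weight s a), zpow_add, Circle.coe_mul,
        (rotPhase_zpow_eq_one_iff k _).mpr (ha x L hL s hs), one_mul]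
    · rw [hψ.2 s hs, mul_zero, mul_zero]
  · rw [phaseOp_mulVec, hψ.2 s hs, mul_zero]

theorem phaseOp_mem_undetectable_iff {a : Cube m → ℤ} (hqr : q ≤ r) :
    phaseOp k a ∈ undetectable (code m q r) k ↔
      ∀ (x : Cube m) (L : Finset (Fin m)), L.card = m - q → ∀ s, IsCodeword r s →
        (2 : ℤ) ^ (k + 1) ∣ weight (flip (subcube x L) s) a - weight s a := by
  constructor
  · rintro ⟨-, h⟩ x L hL s hs
    have hX : onSet gateX (subcube x L) ∈ stabilizers (code m q r) 0 :=
      ⟨onSet_gateX_mem_pauliGroup _, fun ψ hψ => funext fun t => by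
        rw [onSet_gateX_mulVec, (mem_code_iff.mp hψ).1 x L hL]⟩
    have h1 := congrFun ((h _ hX).2 _ (uniformState_mem_code hqr)) s
    rw [coe_mul_mulVec, coe_mul_mulVec, ← phaseOp_neg, phaseOp_mulVec, onSet_gateX_mulVec,
      phaseOp_mulVec, uniformState_of_isCodeword hs,
      uniformState_of_isCodeword (hs.flip x (by omega)), mul_one, ← Circle.coe_mul, ← zpow_add,
      rotPhase_zpow_eq_one_iff, map_neg] at h1
    rw [← dvd_neg, neg_sub]
    exact h1
  · intro h
    refine ⟨phaseOp_mem_cliffordLevel k a, fun S hS =>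
      ⟨phaseOp_conj_mem_cliffordLevel k a hS.1, fun ψ hψ => ?_⟩⟩
    have hmem : ((phaseOp k a)⁻¹ : Op (Cube m)).1.mulVec ψ ∈ code m q r := by
      rw [← phaseOp_neg]
      refine phaseOp_mulVec_mem_code (fun x L hL s hs => ?_) hψ
      rw [map_neg, map_neg, ← neg_sub', dvd_neg]
      exact h x L hL s hs
    rw [coe_mul_mulVec, coe_mul_mulVec, hS.2 _ hmem, ← coe_mul_mulVec, mul_inv_cancel]
    exact Matrix.one_mulVec ψ

theorem dvd_weight_sub_of_agreeUpToPhase {a b : Cube m → ℤ} (hqr : q ≤ r)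
    (h : AgreeUpToPhase (code m q r) (phaseOp k a) (phaseOp k b))
    {s : Cube m → Fin 2} (hs : IsCodeword r s) : (2 : ℤ) ^ (k + 1) ∣ weight s a - weight s b := by
  obtain ⟨c, -, hc⟩ := h
  have key : ∀ t : Cube m → Fin 2, IsCodeword r t → ((rotPhase k ^ weight t a : Circle) : ℂ) =
      c * ((rotPhase k ^ weight t b : Circle) : ℂ) := by
    intro t ht
    have h1 := congrFun (hc _ (uniformState_mem_code hqr)) t
    simpa [phaseOp_mulVec, uniformState_of_isCodeword ht] using h1
  have hc1 : c = 1 := by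
    have hw : ∀ a : Cube m → ℤ, weight (fun _ => 0) a = 0 := fun a => by simp [weight]
    have h1 := key (fun _ => 0) (LowDegree.one r)
    simpa [hw] using h1.symm
  have h2 := key s hs
  rw [hc1, one_mul] at h2
  rw [← rotPhase_zpow_eq_one_iff, zpow_sub, Circle.ext h2, mul_inv_cancel, Circle.coe_one]

theorem phaseOp_mem_stabilizers_iff {a : Cube m → ℤ} (hqr : q ≤ r) :
    phaseOp k a ∈ stabilizers (code m q r) k ↔
      ∀ s, IsCodeword r s → (2 : ℤ) ^ (k + 1) ∣ weight s a := by
  constructor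
  · rintro ⟨-, h⟩ s hs
    have := dvd_weight_sub_of_agreeUpToPhase (b := 0) (k := k) (a := a) hqr
      ⟨1, norm_one, fun ψ hψ => ?_⟩ hs
    · rwa [map_zero, sub_zero] at this
    · rw [h ψ hψ, phaseOp_zero, one_smul]
      exact (Matrix.one_mulVec ψ).symm
  · refine fun h => ⟨phaseOp_mem_cliffordLevel k a, fun ψ hψ => funext fun s => ?_⟩
    rw [phaseOp_mulVec]
    by_cases hs : IsCodeword r s
    · rw [(rotPhase_zpow_eq_one_iff k _).mpr (h s hs), one_mul]
    · rw [(mem_code_iff.mp hψ).2 s hs, mul_zero]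

theorem logicallyEquiv_phaseOp_iff {a b : Cube m → ℤ} (hqr : q ≤ r) :
    LogicallyEquiv (code m q r) k (phaseOp k a) (phaseOp k b) ↔
      ∀ s, IsCodeword r s → (2 : ℤ) ^ (k + 1) ∣ weight s a - weight s b := by
  rw [LogicallyEquiv, ← phaseOp_neg, ← phaseOp_add, phaseOp_mem_stabilizers_iff hqr]
  simp only [neg_add_eq_sub, map_sub]

end Code

/-! ### Subcube operators -/

section SubcubeOps

variable {m q r k : ℕ}

open Classical in
/-- The exponents `h v` on the vertices of `A`, and `0` elsewhere. -/
def cubeCoeff (h : Cube m → ℤˣ) (A : Set (Cube m)) (v : Cube m) : ℤ :=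
  if v ∈ A then (h v : ℤ) else 0

theorem signedZ_eq (k : ℕ) (A : Set (Cube m)) : signedZ k A = phaseOp k (cubeCoeff chi A) := by
  unfold signedZ phaseOp
  congr 1
  ext1 v
  unfold cubeCoeff
  rw [chi_eq, rotZ_eq]
  split_ifs
  · simp
  · simp [phaseGate_inv]
  · simp [phaseGate_one]

theorem unsignedZ_eq (k : ℕ) (A : Set (Cube m)) :
    unsignedZ k A = phaseOp k (cubeCoeff (fun _ => 1) A) := by
  unfold unsignedZ onSet phaseOp
  congr 1
  ext1 v
  unfold cubeCoeff
  rw [rotZ_eq]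
  split_ifs
  · simp
  · simp [phaseGate_one]

theorem signedProd_eq {ι : Type} (k : ℕ) (T : Finset ι) (A : ι → Set (Cube m)) :
    signedProd k T A = phaseOp k (∑ i ∈ T, cubeCoeff chi (A i)) := by
  classical
  induction T using Finset.induction_on with
  | empty =>
    rw [Finset.sum_empty, phaseOp_zero]
    exact Finset.noncommProd_empty _ _
  | insert i T hi ih =>
    rw [Finset.sum_insert hi, phaseOp_add, ← ih, ← signedZ_eq]
    exact Finset.noncommProd_insert_of_notMem _ _ _ _ hi

theorem unsignedProd_eq {ι : Type} (k : ℕ) (T : Finset ι) (A : ι → Set (Cube m)) :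
    unsignedProd k T A = phaseOp k (∑ i ∈ T, cubeCoeff (fun _ => 1) (A i)) := by
  classical
  induction T using Finset.induction_on with
  | empty =>
    rw [Finset.sum_empty, phaseOp_zero]
    exact Finset.noncommProd_empty _ _
  | insert i T hi ih =>
    rw [Finset.sum_insert hi, phaseOp_add, ← ih, ← unsignedZ_eq]
    exact Finset.noncommProd_insert_of_notMem _ _ _ _ hi

theorem weight_cubeCoeff (s : Cube m → Fin 2) (h : Cube m → ℤˣ) (x : Cube m)
    (K : Finset (Fin m)) :
    weight s (cubeCoeff h (subcube x K)) =
      ∑ T ∈ K.powerset, if s (x + ind T) = 0 then 0 else (h (x + ind T) : ℤ) := by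
  classical
  rw [← sum_subcube x K fun v => if s v = 0 then 0 else (h v : ℤ)]
  refine Finset.sum_congr rfl fun v _ => ?_
  unfold cubeCoeff
  split_ifs <;> rfl

theorem two_mul_weight_cubeCoeff (s : Cube m → Fin 2) (h : Cube m → ℤˣ) (x : Cube m)
    (K : Finset (Fin m)) :
    2 * weight s (cubeCoeff h (subcube x K)) =
      ∑ T ∈ K.powerset, (h (x + ind T) : ℤ) -
        ∑ T ∈ K.powerset, ((h (x + ind T) * sgn (s (x + ind T)) : ℤˣ) : ℤ) := by
  rw [weight_cubeCoeff, Finset.mul_sum, ← Finset.sum_sub_distrib]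
  refine Finset.sum_congr rfl fun T _ => ?_
  unfold sgn
  split_ifs
  · simp
  · push_cast
    ring

theorem dvd_weight_cubeCoeff (hr : 0 < r) {s : Cube m → Fin 2} (hs : IsCodeword r s)
    {h : Cube m → ℤˣ} (hh : LowDegree r h) (x : Cube m) {K : Finset (Fin m)}
    (hK : k * r < K.card) : (2 : ℤ) ^ k ∣ weight s (cubeCoeff h (subcube x K)) := by
  refine Int.dvd_of_mul_dvd_mul_left (a := 2) two_ne_zero ?_
  rw [two_mul_weight_cubeCoeff, ← pow_succ']
  exact dvd_sub (hh.dvd_sum hr x hK) ((hh.mul hs).dvd_sum hr x hK)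

open Classical in
theorem weight_flip_sub (s : Cube m → Fin 2) (h : Cube m → ℤˣ) {A B C : Set (Cube m)}
    (hC : A ∩ B = C) :
    weight (flip B s) (cubeCoeff h A) - weight s (cubeCoeff h A) =
      ∑ v, if v ∈ C then ((h v * sgn (s v) : ℤˣ) : ℤ) else 0 := by
  subst hC
  simp only [weight, AddMonoidHom.coe_mk, ZeroHom.coe_mk]
  rw [← Finset.sum_sub_distrib]
  refine Finset.sum_congr rfl fun v _ => ?_
  have hbit : ∀ (b : Fin 2) (z : ℤ), ((if b + 1 = 0 then 0 else z) - if b = 0 then 0 else z) =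
      z * sgn b := by
    intro b z
    fin_cases b <;> simp [sgn]
  unfold cubeCoeff flip
  by_cases hA : v ∈ A <;> by_cases hB : v ∈ B <;> simp [hA, hB, hbit]

theorem phaseOp_cubeCoeff_mem_undetectable (hqr : q < r) {h : Cube m → ℤˣ}
    (hh : LowDegree r h) (x : Cube m) {K : Finset (Fin m)} (hK : q + k * r < K.card) :
    phaseOp k (cubeCoeff h (subcube x K)) ∈ undetectable (code m q r) k := by
  classical
  rw [phaseOp_mem_undetectable_iff hqr.le]
  intro y L hL s hs
  by_cases hne : (subcube x K ∩ subcube y L).Nonempty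
  · obtain ⟨z, hzK, hzL⟩ := hne
    rw [subcube_eq_of_mem hzK, subcube_eq_of_mem hzL, weight_flip_sub s h (subcube_inter z K L),
      sum_subcube z (K ∩ L) fun v => ((h v * sgn (s v) : ℤˣ) : ℤ)]
    refine (hh.mul hs).dvd_sum (by omega) z ?_
    have h1 := Finset.card_union_add_card_inter K L
    have h2 := Finset.card_le_univ (K ∪ L)
    rw [Fintype.card_fin] at h2
    omega
  · rw [weight_flip_sub s h (Set.not_nonempty_iff_eq_empty.mp hne)]
    simp

theorem exists_isCodeword_sum_chi (n : ℕ) (M : Finset (Fin m)) (hM : M.card ≤ n * r)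
    (x : Cube m) : ∃ s : Cube m → Fin 2, IsCodeword r s ∧
      ¬ (2 : ℤ) ^ (n + 1) ∣ ∑ T ∈ M.powerset, ((chi (x + ind T) * sgn (s (x + ind T)) : ℤˣ) : ℤ) ∧
      ∀ K : Finset (Fin m), ¬ K ⊆ M →
        ∑ T ∈ K.powerset, ((chi (x + ind T) * sgn (s (x + ind T)) : ℤˣ) : ℤ) = 0 := by
  obtain ⟨g, hg, hinv, j, hj, hsum⟩ := exists_lowDegree_sum_chi n M hM
  obtain ⟨s, hs, hsg⟩ := exists_isCodeword (hg.translate (-x))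
  refine ⟨s, hs, fun hdvd => ?_, fun K hK => ?_⟩
  · have h1 : ∑ T ∈ M.powerset, ((chi (x + ind T) * sgn (s (x + ind T)) : ℤˣ) : ℤ) =
        chi x * ∑ T ∈ M.powerset, ((chi (ind T) * g (ind T) : ℤˣ) : ℤ) := by
      rw [Finset.mul_sum]
      refine Finset.sum_congr rfl fun T _ => ?_
      rw [hsg, neg_add_cancel_left, chi_add, mul_assoc]
      push_cast
      ring
    rw [h1, (chi x).isUnit.dvd_mul_left, ← Int.natAbs_dvd_natAbs, hsum, Int.natAbs_pow] at hdvd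
    have := Nat.pow_dvd_pow_iff_le_right (x := 2) (by norm_num) |>.mp hdvd
    omega
  · obtain ⟨a, ha, haM⟩ := Finset.not_subset.mp hK
    refine sum_chi_eq_zero (g := fun v => sgn (s v)) (fun v => ?_) ha x
    rw [hsg, hsg, ← add_assoc]
    exact hinv _ _ (Finset.disjoint_singleton_left.mpr haM)

theorem lt_card_of_signedZ_mem_undetectable (hqr : q < r) (hrm : r ≤ m) {x : Cube m}
    {K : Finset (Fin m)} (h : signedZ k (subcube x K) ∈ undetectable (code m q r) k) :
    q + k * r < K.card := by
  classical
  by_contra hK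
  obtain ⟨L, hL, hKL⟩ : ∃ L : Finset (Fin m), L.card = m - q ∧ (K ∩ L).card ≤ k * r := by
    have huniv : (Finset.univ : Finset (Fin m)).card = m := by simp
    rcases le_total K.card q with hq | hq
    · obtain ⟨N, hKN, -, hN⟩ := Finset.exists_subsuperset_card_eq (Finset.subset_univ K) hq
        (by omega)
      refine ⟨Nᶜ, by rw [Finset.card_compl, hN, Fintype.card_fin], ?_⟩
      rw [Finset.disjoint_iff_inter_eq_empty.mp
        (disjoint_compl_right_iff.mpr hKN)]
      simp
    · obtain ⟨N, hNK, hN⟩ := Finset.exists_subset_card_eq hq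
      refine ⟨Nᶜ, by rw [Finset.card_compl, hN, Fintype.card_fin], ?_⟩
      rw [← Finset.sdiff_eq_inter_compl, Finset.card_sdiff_of_subset hNK]
      omega
  obtain ⟨s, hs, hnd, -⟩ := exists_isCodeword_sum_chi k (K ∩ L) hKL x
  rw [signedZ_eq, phaseOp_mem_undetectable_iff hqr.le] at h
  have h1 := h x L hL s hs
  rw [weight_flip_sub s chi (subcube_inter x K L),
    sum_subcube x (K ∩ L) fun v => ((chi v * sgn (s v) : ℤˣ) : ℤ)] at h1
  exact hnd h1

theorem weight_subcube_union (s : Cube m → Fin 2) (h : Cube m → ℤˣ) {I K : Finset (Fin m)}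
    (hIK : Disjoint I K) :
    weight s (cubeCoeff h (std (I ∪ K) : Set (Cube m))) =
      ∑ J ∈ I.powerset, weight s (cubeCoeff h (subcube (ind J) K)) := by
  rw [std_eq_subcube, weight_cubeCoeff,
    sum_powerset_ind_union (fun v => if s v = 0 then 0 else (h v : ℤ)) I K hIK]
  simp only [zero_add, weight_cubeCoeff]

theorem dvd_weight_sub_sum (hr : 0 < r) {s : Cube m → Fin 2} (hs : IsCodeword r s)
    {h : Cube m → ℤˣ} (hh : LowDegree r h) {x : Cube m} {K : Finset (Fin m)}
    (hK : k * r < K.card) (hx : Disjoint (supp x) K) :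
    (2 : ℤ) ^ (k + 1) ∣ weight s (cubeCoeff h (subcube x K)) -
      weight s (∑ I ∈ (supp x).powerset.filter fun I => I.card + K.card ≤ (k + 1) * r,
        cubeCoeff h (std (I ∪ K) : Set (Cube m))) := by
  have hlarge : (2 : ℤ) ^ (k + 1) ∣
      ∑ I ∈ (supp x).powerset.filter fun I => ¬ I.card + K.card ≤ (k + 1) * r,
        weight s (cubeCoeff h (std (I ∪ K) : Set (Cube m))) := by
    refine Finset.dvd_sum fun I hI => ?_
    rw [Finset.mem_filter, Finset.mem_powerset] at hI
    rw [std_eq_subcube]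
    refine dvd_weight_cubeCoeff hr hs hh 0 ?_
    rw [Finset.card_union_of_disjoint (hx.mono_left hI.1)]
    omega
  have hall : (2 : ℤ) ^ (k + 1) ∣ weight s (cubeCoeff h (subcube x K)) -
      ∑ I ∈ (supp x).powerset, weight s (cubeCoeff h (std (I ∪ K) : Set (Cube m))) := by
    rw [Finset.sum_congr rfl fun I hI =>
        weight_subcube_union s h (hx.mono_left (Finset.mem_powerset.mp hI)),
      sum_powerset_powerset, ← Finset.sum_erase_add _ _ (Finset.mem_powerset_self (supp x)),
      ind_supp, Nat.sub_self, pow_zero, one_smul, sub_add_cancel_right, dvd_neg]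
    refine Finset.dvd_sum fun J hJ => ?_
    obtain ⟨hne, hJ⟩ := Finset.mem_erase.mp hJ
    have hlt := Finset.card_lt_card (lt_of_le_of_ne (Finset.mem_powerset.mp hJ) hne)
    obtain ⟨n, hn⟩ := Nat.exists_eq_add_of_lt hlt
    rw [show (supp x).card - J.card = n + 1 by omega, nsmul_eq_mul, pow_succ' 2 n, mul_comm,
      pow_succ, Nat.cast_mul, Nat.cast_ofNat, ← mul_assoc]
    exact Dvd.dvd.mul_right (mul_dvd_mul_right (dvd_weight_cubeCoeff hr hs hh _ hK) 2) _
  rw [map_sum]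
  rw [← Finset.sum_filter_add_sum_filter_not _ fun I => I.card + K.card ≤ (k + 1) * r] at hall
  rw [← sub_sub] at hall
  simpa only [sub_add_cancel] using dvd_add hall hlarge

theorem disjoint_supp_of_minimal {x : Cube m} {K : Finset (Fin m)}
    (hx : ∀ y ∈ subcube x K, hammingNorm x ≤ hammingNorm y) : Disjoint (supp x) K := by
  rw [Finset.disjoint_left]
  intro i hi hiK
  have hi' : x i ≠ 0 := by simpa [supp] using hi
  have hmem : Function.update x i 0 ∈ subcube x K := by
    rw [mem_subcube]
    intro j hj
    exact Function.update_of_ne (fun h : j = i => hj (h ▸ hiK)) _ _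
  refine absurd (hx _ hmem) (not_le.mpr (Finset.card_lt_card ?_))
  rw [Finset.ssubset_iff_of_subset]
  · exact ⟨i, by simpa using hi', by simp⟩
  · intro j hj
    simp only [Finset.mem_filter, Finset.mem_univ, true_and] at hj ⊢
    by_cases h : j = i
    · rwa [h]
    · rwa [Function.update_of_ne h] at hj

theorem exists_subcube_eq_disjoint (x : Cube m) (K : Finset (Fin m)) :
    ∃ y : Cube m, subcube x K = subcube y K ∧ Disjoint (supp y) K := by
  refine ⟨fun i => if i ∈ K then 0 else x i, subcube_eq_of_mem ?_, ?_⟩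
  · rw [mem_subcube]
    exact fun i hi => if_neg hi
  · rw [Finset.disjoint_right]
    intro i hi
    simp [supp, hi]

theorem eq_of_agreeUpToPhase_signedProd (hqr : q < r) {F F' : Finset (Finset (Fin m))}
    (hF : F ⊆ indexSet m q r k) (hF' : F' ⊆ indexSet m q r k)
    (h : AgreeUpToPhase (code m q r) (signedProd k F fun K => (std K : Set (Cube m)))
      (signedProd k F' fun K => (std K : Set (Cube m)))) : F = F' := by
  by_contra hne
  have hsub : symmDiff F F' ⊆ indexSet m q r k :=
    (symmDiff_le_sup : symmDiff F F' ≤ F ⊔ F').trans (Finset.union_subset hF hF')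
  obtain ⟨K₀, hK₀, hmin⟩ := (symmDiff F F').exists_minimal
    (Finset.nonempty_iff_ne_empty.mpr fun h => hne (symmDiff_eq_bot.mp h))
  have hK₀Q := hsub hK₀
  rw [indexSet, Finset.mem_filter] at hK₀Q
  obtain ⟨s, hs, hnd, hzero⟩ := exists_isCodeword_sum_chi (k + 1) K₀ hK₀Q.2.2 0
  rw [signedProd_eq, signedProd_eq] at h
  have hdvd := dvd_weight_sub_of_agreeUpToPhase hqr.le h hs
  set w : Finset (Fin m) → ℤ := fun K => weight s (cubeCoeff chi (std K : Set (Cube m))) with hw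
  have hw2 : ∀ K ∈ indexSet m q r k, 2 * w K =
      -∑ T ∈ K.powerset, ((chi (0 + ind T) * sgn (s (0 + ind T)) : ℤˣ) : ℤ) := by
    intro K hK
    rw [indexSet, Finset.mem_filter] at hK
    obtain ⟨a, ha⟩ := Finset.card_pos.mp (show 0 < K.card by omega)
    have h0 := sum_chi_eq_zero (g := fun _ : Cube m => 1) (fun _ => rfl) ha 0
    simp only [mul_one] at h0
    simp only [hw, std_eq_subcube]
    rw [two_mul_weight_cubeCoeff, h0, zero_sub]
  have hdiff : ∑ K ∈ F, w K - ∑ K ∈ F', w K =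
      ∑ K ∈ F \ F', w K - ∑ K ∈ F' \ F, w K := by
    exact Finset.sum_sdiff_sub_sum_sdiff.symm
  have hother : ∀ K ∈ symmDiff F F', K ≠ K₀ → w K = 0 := by
    intro K hK hne
    have h2 := hw2 K (hsub hK)
    rw [hzero K fun hle => hne (hle.antisymm (hmin hK hle))] at h2
    omega
  have hw₀ : (2 : ℤ) ^ (k + 1) ∣ w K₀ := by
    rw [map_sum, map_sum, hdiff] at hdvd
    rcases Finset.mem_symmDiff.mp hK₀ with ⟨hin, hout⟩ | ⟨hin, hout⟩
    · rw [Finset.sum_eq_single_of_mem K₀ (Finset.mem_sdiff.mpr ⟨hin, hout⟩)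
        fun K hK => hother K (Finset.mem_symmDiff.mpr (Or.inl (Finset.mem_sdiff.mp hK))),
        Finset.sum_eq_zero fun K hK => hother K
          (Finset.mem_symmDiff.mpr (Or.inr (Finset.mem_sdiff.mp hK)))
          (fun h => hout (h ▸ (Finset.mem_sdiff.mp hK).1)), sub_zero] at hdvd
      exact hdvd
    · rw [Finset.sum_eq_single_of_mem (s := F' \ F) K₀ (Finset.mem_sdiff.mpr ⟨hin, hout⟩)
        fun K hK => hother K (Finset.mem_symmDiff.mpr (Or.inr (Finset.mem_sdiff.mp hK))),
        Finset.sum_eq_zero fun K hK => hother K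
          (Finset.mem_symmDiff.mpr (Or.inl (Finset.mem_sdiff.mp hK)))
          (fun h => hout (h ▸ (Finset.mem_sdiff.mp hK).1)), zero_sub, dvd_neg] at hdvd
      exact hdvd
  refine hnd ?_
  rw [← dvd_neg, ← hw2 K₀ (hsub hK₀), pow_succ']
  exact mul_dvd_mul_left 2 hw₀

theorem signedZ_std_mem_logicals (hqr : q < r) {K : Finset (Fin m)}
    (hK : K ∈ indexSet m q r k) :
    signedZ k (std K : Set (Cube m)) ∈ logicals (code m q r) k := by
  refine ⟨?_, fun hstab => ?_⟩
  · rw [indexSet, Finset.mem_filter] at hK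
    rw [signedZ_eq, std_eq_subcube]
    exact phaseOp_cubeCoeff_mem_undetectable hqr (chi_lowDegree (by omega)) 0 (by omega)
  · refine Finset.singleton_ne_empty K (eq_of_agreeUpToPhase_signedProd hqr
      (Finset.singleton_subset_iff.mpr hK) (Finset.empty_subset _) ⟨1, norm_one, fun ψ hψ => ?_⟩)
    rw [signedProd_eq, signedProd_eq, Finset.sum_singleton, Finset.sum_empty, ← signedZ_eq,
      phaseOp_zero, hstab.2 ψ hψ, one_smul]
    exact (Matrix.one_mulVec ψ).symm

theorem signedGroup_eq_phaseOp (hqr : q < r) (hrm : r ≤ m) {U : Op (Cube m)}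
    (hU : U ∈ signedGroup m q r k) :
    ∃ a : Cube m → ℤ, U = phaseOp k a ∧
      (∀ s, IsCodeword r s → (2 : ℤ) ^ k ∣ weight s a) ∧
      ∃ F ⊆ indexSet m q r k, ∀ s, IsCodeword r s →
        (2 : ℤ) ^ (k + 1) ∣ weight s a -
          ∑ K ∈ F, weight s (cubeCoeff chi (std K : Set (Cube m))) := by
  have hr : 0 < r := by omega
  have hdvdF : ∀ F ⊆ indexSet m q r k, ∀ s, IsCodeword r s →
      (2 : ℤ) ^ k ∣ ∑ K ∈ F, weight s (cubeCoeff chi (std K : Set (Cube m))) := by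
    intro F hF s hs
    refine Finset.dvd_sum fun K hK => ?_
    have hKQ := hF hK
    rw [indexSet, Finset.mem_filter] at hKQ
    rw [std_eq_subcube]
    exact dvd_weight_cubeCoeff hr hs (chi_lowDegree hr) 0 (by omega)
  induction hU using Subgroup.closure_induction with
  | mem U hU =>
    obtain ⟨hlog, x, K, rfl⟩ := hU
    have hK := lt_card_of_signedZ_mem_undetectable hqr hrm hlog.1
    obtain ⟨y, hxy, hdisj⟩ := exists_subcube_eq_disjoint x K
    refine ⟨_, signedZ_eq k _, fun s hs =>
      dvd_weight_cubeCoeff hr hs (chi_lowDegree hr) x (by omega),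
      ((supp y).powerset.filter fun I => I.card + K.card ≤ (k + 1) * r).image (· ∪ K),
      ?_, fun s hs => ?_⟩
    · intro J hJ
      obtain ⟨I, hI, rfl⟩ := Finset.mem_image.mp hJ
      rw [Finset.mem_filter, Finset.mem_powerset] at hI
      rw [indexSet, Finset.mem_filter, Finset.card_union_of_disjoint (hdisj.mono_left hI.1)]
      exact ⟨Finset.mem_univ _, by omega, hI.2⟩
    · rw [Finset.sum_image, hxy, ← map_sum]
      · exact dvd_weight_sub_sum hr hs (chi_lowDegree hr) (by omega) hdisj
      · intro I hI J hJ hIJ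
        simp only [Finset.coe_filter, Set.mem_ofPred_eq, Finset.mem_powerset] at hI hJ
        rw [← Finset.union_sdiff_cancel_right (hdisj.mono_left hI.1),
          ← Finset.union_sdiff_cancel_right (hdisj.mono_left hJ.1)]
        exact congrArg (· \ K) hIJ
  | one =>
    refine ⟨0, (phaseOp_zero k).symm, fun s _ => ?_, ∅, Finset.empty_subset _, fun s _ => ?_⟩
    · rw [map_zero]; exact dvd_zero _
    · rw [map_zero, Finset.sum_empty, sub_zero]; exact dvd_zero _
  | mul U V _ _ hU hV =>
    obtain ⟨a, rfl, ha, F, hF, haF⟩ := hU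
    obtain ⟨b, rfl, hb, F', hF', hbF⟩ := hV
    refine ⟨a + b, (phaseOp_add k a b).symm,
      fun s hs => by rw [map_add]; exact dvd_add (ha s hs) (hb s hs), symmDiff F F',
      (symmDiff_le_sup : symmDiff F F' ≤ F ⊔ F').trans (Finset.union_subset hF hF'),
      fun s hs => ?_⟩
    set w : Finset (Fin m) → ℤ := fun K => weight s (cubeCoeff chi (std K : Set (Cube m)))
    have h1 : ∑ K ∈ symmDiff F F', w K =
        ∑ K ∈ F, w K + ∑ K ∈ F', w K - 2 * ∑ K ∈ F ∩ F', w K := by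
      rw [symmDiff, Finset.sup_eq_union, Finset.sum_union disjoint_sdiff_sdiff,
        ← Finset.sum_inter_add_sum_sdiff F F', ← Finset.sum_inter_add_sum_sdiff F' F,
        Finset.inter_comm F' F]
      ring
    have h2 : (2 : ℤ) ^ (k + 1) ∣ 2 * ∑ K ∈ F ∩ F', w K := by
      rw [pow_succ']
      exact mul_dvd_mul_left 2 (hdvdF _ (Finset.inter_subset_left.trans hF) s hs)
    rw [h1, map_add, show ∀ x y z t u : ℤ, x + y - (z + t - u) = x - z + (y - t) + u from
      fun x y z t u => by ring]
    exact dvd_add (dvd_add (haF s hs) (hbF s hs)) h2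
  | inv U _ hU =>
    obtain ⟨a, rfl, ha, F, hF, haF⟩ := hU
    refine ⟨-a, (phaseOp_neg k a).symm,
      fun s hs => by rw [map_neg, dvd_neg]; exact ha s hs, F, hF, fun s hs => ?_⟩
    have h2 := mul_dvd_mul_left 2 (hdvdF F hF s hs)
    rw [← pow_succ'] at h2
    rw [map_neg, ← dvd_neg]
    rw [show ∀ x y : ℤ, -(-x - y) = x - y + 2 * y from fun x y => by ring]
    exact dvd_add (haF s hs) h2

end SubcubeOps
end QRM

end

open QRM in
theorem mainTheorem4 (m q r k : ℕ) (hqr : q < r) (hrm : r ≤ m) :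
    -- the standard operators indexed by `𝒬_k` are non-trivial level-`k` logicals
    (∀ K ∈ indexSet m q r k,
      signedZ k (std K : Set (Cube m)) ∈ logicals (code m q r) k) ∧
    -- the logical signed operators have order two modulo Clifford stabilizers
    (∀ U ∈ signedGroup m q r k, U * U ∈ stabilizers (code m q r) k) ∧
    -- spanning
    (∀ U ∈ signedGroup m q r k, ∃ F ⊆ indexSet m q r k,
      LogicallyEquiv (code m q r) k U
        (signedProd k F fun K => (std K : Set (Cube m)))) ∧
    -- independence
    (∀ F ⊆ indexSet m q r k, ∀ F' ⊆ indexSet m q r k,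
      AgreeUpToPhase (code m q r)
        (signedProd k F fun K => (std K : Set (Cube m)))
        (signedProd k F' fun K => (std K : Set (Cube m))) → F = F') ∧
    -- explicit decompositions, signed and unsigned
    (∀ (x : Cube m) (K : Finset (Fin m)), q + k * r + 1 ≤ K.card →
      (∀ y ∈ subcube x K, hammingNorm x ≤ hammingNorm y) →
      LogicallyEquiv (code m q r) k (signedZ k (subcube x K))
        (signedProd k
          ((supp x).powerset.filter fun I => I.card + K.card ≤ (k + 1) * r)
          fun I => (std (I ∪ K) : Set (Cube m))) ∧
      LogicallyEquiv (code m q r) k (unsignedZ k (subcube x K))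
        (unsignedProd k
          ((supp x).powerset.filter fun I => I.card + K.card ≤ (k + 1) * r)
          fun I => (std (I ∪ K) : Set (Cube m)))) := by
  have hr : 0 < r := by omega
  refine ⟨fun K hK => signedZ_std_mem_logicals hqr hK, fun U hU => ?_, fun U hU => ?_,
    fun F hF F' hF' h => eq_of_agreeUpToPhase_signedProd hqr hF hF' h,
    fun x K hK hx => ⟨?_, ?_⟩⟩
  · obtain ⟨a, rfl, ha, -⟩ := signedGroup_eq_phaseOp hqr hrm hU
    rw [← phaseOp_add, phaseOp_mem_stabilizers_iff hqr.le]
    intro s hs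
    rw [map_add, ← two_mul, pow_succ']
    exact mul_dvd_mul_left 2 (ha s hs)
  · obtain ⟨a, rfl, -, F, hF, haF⟩ := signedGroup_eq_phaseOp hqr hrm hU
    refine ⟨F, hF, ?_⟩
    rw [signedProd_eq, logicallyEquiv_phaseOp_iff hqr.le]
    intro s hs
    rw [map_sum]
    exact haF s hs
  · rw [signedZ_eq, signedProd_eq, logicallyEquiv_phaseOp_iff hqr.le]
    exact fun s hs => dvd_weight_sub_sum hr hs (chi_lowDegree hr) (by omega)
      (disjoint_supp_of_minimal hx)
  · rw [unsignedZ_eq, unsignedProd_eq, logicallyEquiv_phaseOp_iff hqr.le]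
    exact fun s hs => dvd_weight_sub_sum hr hs (LowDegree.one r) (by omega)
      (disjoint_supp_of_minimal hx)
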